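/- Number the symbols $x_1,\dots,x_k$. Let $L(k)$ be the set of formal expressions obtained by applying iterated binary brackets to $x_1,\dots,x_k$ such that each symbol appears exactly once and, in every bracket $[a,b]$, the smallest index inside the bracket appears in $a$ and the largest one in $b$. The sets $L(k)$ form a non-symmetric operad in sets, whose unit is the expression $x_1$: for $B\in L(n)$, the composition $A\circ_i B$ replaces $x_i$ in $A$ by $B$ with its indices shifted by $i-1$, and shifts the indices of $A$ larger than $i$ by $n-1$. An expression that is not a single symbol is called prime if its outer bracket is the only bracket in it whose indices form an interval of consecutive integers; let $P(k)\subset L(k)$ be the set of prime expressions (so $P(k)=\emptyset$ for $k<2$). For a commutative ring $R$ let $\mathrm{Lie}(k)$ be the $R$-submodule of the free Lie algebra over $R$ on $x_1,\dots,x_k$ spanned by the iterated brackets in which each generator appears exactly once. With the partial compositions given by substitution and renumbering of the generators, and the symmetric group actions forgotten, $\mathrm{Lie}$ is a non-symmetric operad in $R$-modules. **Theorem.** Let $R$ be a commutative ring. 1. $L$ is the free non-symmetric operad in sets on the sequence $P=(P(n))_n$: for every non-symmetric operad $Q$ in sets, every sequence of maps $P(n)\to Q(n)$ extends uniquely to a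 morphism of operads $L\to Q$. 2. There is a morphism $\beta\colon R[L]\to\mathrm{Lie}$ of non-symmetric operads in $R$-modules that sends each formal expression to the same expression in $\mathrm{Lie}$, where $R[L]$ is the $R$-linear span of $L$, and $\beta$ is an isomorphism. 3. Consequently $\mathrm{Lie}$ is a free non-symmetric operad in $R$-modules. Precisely, it is free on the sequence of free modules $R[P(n)]$, embedded by reading prime expressions in $\mathrm{Lie}(n)$: for every non-symmetric operad $Q$ in $R$-modules, every sequence of linear maps $R[P(n)]\to Q(n)$ extends uniquely to a morphism of operads $\mathrm{Lie}\to Q$. -/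

import Mathlib

/-! ### Non-symmetric operads

Operads are given by their unit and partial compositions `a ∘ᵢ b`.  Inputs are numbered from `0`, so
an operation of arity `m` has inputs `i : Fin m`.  The arity `k = m + n - 1` of `a ∘ᵢ b`, for `a` of
arity `m` and `b` of arity `n`, is recorded by a proof of `m + n = k + 1`. -/

/-- A non-symmetric operad in the category of sets. -/
structure NSOperad.{u} where
  /-- the operations of arity `n` -/
  obj : ℕ → Type u
  /-- the unit -/
  one : obj 1
  /-- the partial compositions `a ∘ᵢ b` -/
  circ : ∀ {m n k : ℕ}, m + n = k + 1 → Fin m → obj m → obj n → obj k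
  one_circ : ∀ {n : ℕ} (h : 1 + n = n + 1) (b : obj n), circ h 0 one b = b
  circ_one : ∀ {m : ℕ} (h : m + 1 = m + 1) (i : Fin m) (a : obj m), circ h i a one = a
  /-- sequential composition: `(a ∘ᵢ b) ∘ᵢ₊ⱼ c = a ∘ᵢ (b ∘ⱼ c)` -/
  circ_seq : ∀ {m n p k q l : ℕ} (h₁ : m + n = k + 1) (h₂ : k + p = l + 1) (h₃ : n + p = q + 1)
    (h₄ : m + q = l + 1) (i : Fin m) (j : Fin n) (a : obj m) (b : obj n) (c : obj p),
    circ h₂ ⟨i + j, by omega⟩ (circ h₁ i a b) c = circ h₄ i a (circ h₃ j b c)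
  /-- parallel composition: `(a ∘ᵢ b) ∘ⱼ₊ₙ₋₁ c = (a ∘ⱼ c) ∘ᵢ b` for `i < j`, `b` of arity `n` -/
  circ_par : ∀ {m n p k q l : ℕ} (h₁ : m + n = k + 1) (h₂ : k + p = l + 1) (h₃ : m + p = q + 1)
    (h₄ : q + n = l + 1) (i j : Fin m) (hij : i < j) (a : obj m) (b : obj n) (c : obj p),
    circ h₂ ⟨j + n - 1, by omega⟩ (circ h₁ i a b) c = circ h₄ ⟨i, by omega⟩ (circ h₃ j a c) b

/-- A morphism of non-symmetric operads in sets. -/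
structure NSOperad.Hom.{u, v} (O : NSOperad.{u}) (Q : NSOperad.{v}) where
  map : ∀ n, O.obj n → Q.obj n
  map_one : map 1 O.one = Q.one
  map_circ : ∀ {m n k : ℕ} (h : m + n = k + 1) (i : Fin m) (a : O.obj m) (b : O.obj n),
    map k (O.circ h i a b) = Q.circ h i (map m a) (map n b)

/-- `O` is the free non-symmetric operad (in sets) on the sequence of sets `X`, with
`ι : X → O` as the inclusion of the generators (tested on operads `Q` in the universe `w`). -/
def NSOperad.IsFreeOn.{w, u, v} (O : NSOperad.{u}) (X : ℕ → Type v) (ι : ∀ n, X n → O.obj n) :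
    Prop :=
  ∀ (Q : NSOperad.{w}) (f : ∀ n, X n → Q.obj n),
    ∃! φ : NSOperad.Hom O Q, ∀ n x, φ.map n (ι n x) = f n x

/-- A non-symmetric operad in the category of `R`-modules. -/
structure LinNSOperad.{u, v} (R : Type u) [CommRing R] where
  /-- the operations of arity `n` -/
  obj : ℕ → Type v
  [grp : ∀ n, AddCommGroup (obj n)]
  [mod : ∀ n, Module R (obj n)]
  /-- the unit -/
  one : obj 1
  /-- the partial compositions `a ∘ᵢ b`, bilinear -/
  circ : ∀ {m n k : ℕ}, m + n = k + 1 → Fin m → (obj m →ₗ[R] obj n →ₗ[R] obj k)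
  one_circ : ∀ {n : ℕ} (h : 1 + n = n + 1) (b : obj n), circ h 0 one b = b
  circ_one : ∀ {m : ℕ} (h : m + 1 = m + 1) (i : Fin m) (a : obj m), circ h i a one = a
  /-- sequential composition: `(a ∘ᵢ b) ∘ᵢ₊ⱼ c = a ∘ᵢ (b ∘ⱼ c)` -/
  circ_seq : ∀ {m n p k q l : ℕ} (h₁ : m + n = k + 1) (h₂ : k + p = l + 1) (h₃ : n + p = q + 1)
    (h₄ : m + q = l + 1) (i : Fin m) (j : Fin n) (a : obj m) (b : obj n) (c : obj p),
    circ h₂ ⟨i + j, by omega⟩ (circ h₁ i a b) c = circ h₄ i a (circ h₃ j b c)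
  /-- parallel composition: `(a ∘ᵢ b) ∘ⱼ₊ₙ₋₁ c = (a ∘ⱼ c) ∘ᵢ b` for `i < j`, `b` of arity `n` -/
  circ_par : ∀ {m n p k q l : ℕ} (h₁ : m + n = k + 1) (h₂ : k + p = l + 1) (h₃ : m + p = q + 1)
    (h₄ : q + n = l + 1) (i j : Fin m) (hij : i < j) (a : obj m) (b : obj n) (c : obj p),
    circ h₂ ⟨j + n - 1, by omega⟩ (circ h₁ i a b) c = circ h₄ ⟨i, by omega⟩ (circ h₃ j a c) b

attribute [instance] LinNSOperad.grp LinNSOperad.mod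

/-- A morphism of non-symmetric operads in `R`-modules. -/
structure LinNSOperad.Hom.{u, v, w} {R : Type u} [CommRing R] (O : LinNSOperad.{u, v} R)
    (Q : LinNSOperad.{u, w} R) where
  map : ∀ n, O.obj n →ₗ[R] Q.obj n
  map_one : map 1 O.one = Q.one
  map_circ : ∀ {m n k : ℕ} (h : m + n = k + 1) (i : Fin m) (a : O.obj m) (b : O.obj n),
    map k (O.circ h i a b) = Q.circ h i (map m a) (map n b)

/-- `O` is the free non-symmetric operad in `R`-modules on the sequence of modules `V`, with
`ι : V → O` as the inclusion of the generators (tested on operads `Q` in the universe `w`). -/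
def LinNSOperad.IsFreeOn.{w, u, v, v'} {R : Type u} [CommRing R] (O : LinNSOperad.{u, v} R)
    (V : ℕ → Type v') [∀ n, AddCommGroup (V n)] [∀ n, Module R (V n)]
    (ι : ∀ n, V n →ₗ[R] O.obj n) : Prop :=
  ∀ (Q : LinNSOperad.{u, w} R) (f : ∀ n, V n →ₗ[R] Q.obj n),
    ∃! φ : LinNSOperad.Hom O Q, ∀ n x, φ.map n (ι n x) = f n x

theorem linearCombination_lmapDomain_single {R : Type*} [CommRing R] {α β γ : Type*}
    (f : α → β → γ) (x : α) (r : R) (y : β) (s : R) :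
    Finsupp.linearCombination R (fun a => Finsupp.lmapDomain R R (f a)) (Finsupp.single x r)
      (Finsupp.single y s) = Finsupp.single (f x y) (r * s) := by
  rw [Finsupp.linearCombination_single, LinearMap.smul_apply, Finsupp.lmapDomain_apply,
    Finsupp.mapDomain_single, Finsupp.smul_single, smul_eq_mul]

/-- The linear span `R[O]` of an operad in sets: `R[O](n)` is the free module on `O(n)`, and the
composition is the bilinear extension of that of `O`. -/
noncomputable def NSOperad.span.{u, v} (R : Type u) [CommRing R] (O : NSOperad.{v}) :
    LinNSOperad.{u, max u v} R where
  obj n := O.obj n →₀ R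
  one := Finsupp.single O.one 1
  circ h i := Finsupp.linearCombination R fun a => Finsupp.lmapDomain R R (O.circ h i a)
  one_circ h b := by
    induction b using Finsupp.induction_linear with
    | zero => simp
    | add f g hf hg => rw [map_add, hf, hg]
    | single x r => simp [O.one_circ]
  circ_one h i a := by
    induction a using Finsupp.induction_linear with
    | zero => simp
    | add f g hf hg => rw [map_add, LinearMap.add_apply, hf, hg]
    | single x r => simp [O.circ_one]
  circ_seq h₁ h₂ h₃ h₄ i j a b c := by
    induction a using Finsupp.induction_linear with
    | zero => simp
    | add f g hf hg => simp only [map_add, LinearMap.add_apply] at *; rw [hf, hg]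
    | single x r =>
    induction b using Finsupp.induction_linear with
    | zero => simp
    | add f g hf hg => simp only [map_add, LinearMap.add_apply] at *; rw [hf, hg]
    | single y s =>
    induction c using Finsupp.induction_linear with
    | zero => simp
    | add f g hf hg => simp only [map_add] at *; rw [hf, hg]
    | single z t =>
      simp only [linearCombination_lmapDomain_single]
      rw [O.circ_seq h₁ h₂ h₃ h₄, mul_assoc]
  circ_par h₁ h₂ h₃ h₄ i j hij a b c := by
    induction a using Finsupp.induction_linear with
    | zero => simp
    | add f g hf hg => simp only [map_add, LinearMap.add_apply] at *; rw [hf, hg]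
    | single x r =>
    induction b using Finsupp.induction_linear with
    | zero => simp
    | add f g hf hg => simp only [map_add, LinearMap.add_apply] at *; rw [hf, hg]
    | single y s =>
    induction c using Finsupp.induction_linear with
    | zero => simp
    | add f g hf hg => simp only [map_add, LinearMap.add_apply] at *; rw [hf, hg]
    | single z t =>
      simp only [linearCombination_lmapDomain_single]
      rw [O.circ_par h₁ h₂ h₃ h₄ i j hij, mul_right_comm]

/-! ### Renumbering of variables in a partial composition -/

/-- The shift by `i` of the `n` variables of `b` in `a ∘ᵢ b`. -/
def shift {m n k : ℕ} (h : m + n = k + 1) (i : Fin m) (x : Fin n) : Fin k :=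
  ⟨i + x, by omega⟩

/-- The substitution that defines `a ∘ᵢ b`: the variable `xᵢ` is replaced by `B`, the variables of
smaller index are kept, and those of larger index are shifted by `n - 1`. -/
def plug {m n k : ℕ} {T : Type*} (h : m + n = k + 1) (i : Fin m) (var : Fin k → T) (B : T)
    (x : Fin m) : T :=
  if hlt : x < i then var ⟨x, by omega⟩
  else if heq : x = i then B
  else var ⟨x + n - 1, by omega⟩

theorem plug_lt {m n k : ℕ} {T : Type*} (h : m + n = k + 1) (i : Fin m) (var : Fin k → T) (B : T)
    (x : Fin m) (hx : x < i) : plug h i var B x = var ⟨x, by omega⟩ := by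
  simp [plug, hx]

theorem plug_self {m n k : ℕ} {T : Type*} (h : m + n = k + 1) (i : Fin m) (var : Fin k → T)
    (B : T) : plug h i var B i = B := by
  simp [plug]

theorem plug_gt {m n k : ℕ} {T : Type*} (h : m + n = k + 1) (i : Fin m) (var : Fin k → T) (B : T)
    (x : Fin m) (hx : i < x) : plug h i var B x = var ⟨x + n - 1, by omega⟩ := by
  simp [plug, hx.not_gt, hx.ne']

theorem plug_comp {m n k : ℕ} {T T' : Type*} (h : m + n = k + 1) (i : Fin m) (var : Fin k → T)
    (B : T) (F : T → T') (x : Fin m) :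
    F (plug h i var B x) = plug h i (fun y => F (var y)) (F B) x := by
  unfold plug; split_ifs <;> rfl

theorem plug_one {m : ℕ} {T : Type*} (h : m + 1 = m + 1) (i : Fin m) (var : Fin m → T) (x : Fin m) :
    plug h i var (var (shift h i 0)) x = var x := by
  rcases lt_trichotomy x i with hx | rfl | hx
  · rw [plug_lt h i _ _ x hx]
  · rw [plug_self]; congr 1
  · rw [plug_gt h i _ _ x hx]; congr 1

theorem plug_seq {m n p k q l : ℕ} {T T' : Type*} (h₁ : m + n = k + 1) (h₂ : k + p = l + 1)
    (h₃ : n + p = q + 1) (h₄ : m + q = l + 1) (i : Fin m) (j : Fin n)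
    (var : Fin k → T) (B : T) (var' : Fin l → T') (C B' : T') (F : T → T')
    (hvar : ∀ x, F (var x) = plug h₂ ⟨i + j, by omega⟩ var' C x) (hB : F B = B') (x : Fin m) :
    F (plug h₁ i var B x) = plug h₄ i var' B' x := by
  rcases lt_trichotomy x i with hx | rfl | hx
  · rw [plug_lt h₁ i _ _ x hx, plug_lt h₄ i _ _ x hx, hvar, plug_lt]
    simp only [Fin.lt_def] at *; omega
  · rw [plug_self, plug_self, hB]
  · rw [plug_gt h₁ i _ _ x hx, plug_gt h₄ i _ _ x hx, hvar, plug_gt]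
    · congr 1; ext; simp only [Fin.lt_def] at *; omega
    · simp only [Fin.lt_def] at *; omega

theorem plug_shift_seq {m n p k q l : ℕ} {T : Type*} (h₁ : m + n = k + 1) (h₂ : k + p = l + 1)
    (h₃ : n + p = q + 1) (h₄ : m + q = l + 1) (i : Fin m) (j : Fin n)
    (var : Fin l → T) (C : T) (x : Fin n) :
    plug h₂ ⟨i + j, by omega⟩ var C (shift h₁ i x)
      = plug h₃ j (fun y => var (shift h₄ i y)) C x := by
  rcases lt_trichotomy x j with hx | rfl | hx
  · rw [plug_lt h₃ j _ _ x hx, plug_lt]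
    · rfl
    · simp only [Fin.lt_def, shift] at *; omega
  · rw [plug_self]; exact plug_self ..
  · rw [plug_gt h₃ j _ _ x hx, plug_gt]
    · congr 1; ext; simp only [Fin.lt_def, shift] at *; omega
    · simp only [Fin.lt_def, shift] at *; omega

theorem plug_par {m n p k q l : ℕ} {T T' T'' : Type*} (h₁ : m + n = k + 1) (h₂ : k + p = l + 1)
    (h₃ : m + p = q + 1) (h₄ : q + n = l + 1) (i j : Fin m) (hij : i < j)
    (var : Fin k → T) (B : T) (var' : Fin q → T') (C : T') (var'' : Fin l → T'') (B'' C'' : T'')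
    (F : T → T'') (G : T' → T'')
    (hF : ∀ x, F (var x) = plug h₂ ⟨j + n - 1, by omega⟩ var'' C'' x) (hB : F B = B'')
    (hG : ∀ x, G (var' x) = plug h₄ ⟨i, by omega⟩ var'' B'' x) (hC : G C = C'') (x : Fin m) :
    F (plug h₁ i var B x) = G (plug h₃ j var' C x) := by
  rcases lt_trichotomy x i with hx | rfl | hx
  · rw [plug_lt h₁ i _ _ x hx, plug_lt h₃ j _ _ x (hx.trans hij), hF, hG, plug_lt, plug_lt]
    · simp only [Fin.lt_def] at *; omega
    · simp only [Fin.lt_def] at *; omega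
  · rw [plug_self, plug_lt h₃ j _ _ x hij, hB, hG]; exact (plug_self ..).symm
  · rcases lt_trichotomy x j with hx' | rfl | hx'
    · rw [plug_gt h₁ i _ _ x hx, plug_lt h₃ j _ _ x hx', hF, hG, plug_lt, plug_gt]
      · simp only [Fin.lt_def] at *; omega
      · simp only [Fin.lt_def] at *; omega
    · rw [plug_gt h₁ i _ _ x hx, plug_self, hC, hF]; exact plug_self ..
    · rw [plug_gt h₁ i _ _ x hx, plug_gt h₃ j _ _ x hx', hF, hG, plug_gt, plug_gt]
      · congr 1; ext; simp only [Fin.lt_def] at *; omega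
      · simp only [Fin.lt_def] at *; omega
      · simp only [Fin.lt_def] at *; omega

theorem plug_shift_par₁ {m n p k q l : ℕ} {T : Type*} (h₁ : m + n = k + 1) (h₂ : k + p = l + 1)
    (h₃ : m + p = q + 1) (h₄ : q + n = l + 1) (i j : Fin m) (hij : i < j)
    (var : Fin l → T) (C : T) (x : Fin n) :
    plug h₂ ⟨j + n - 1, by omega⟩ var C (shift h₁ i x)
      = var (shift h₄ ⟨i, by omega⟩ x) := by
  rw [plug_lt]
  · rfl
  · simp only [Fin.lt_def, shift] at *; omega

theorem plug_shift_par₂ {m n p k q l : ℕ} {T : Type*} (h₁ : m + n = k + 1) (h₂ : k + p = l + 1)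
    (h₃ : m + p = q + 1) (h₄ : q + n = l + 1) (i j : Fin m) (hij : i < j)
    (var : Fin l → T) (B : T) (x : Fin p) :
    plug h₄ ⟨i, by omega⟩ var B (shift h₃ j x)
      = var (shift h₂ ⟨j + n - 1, by omega⟩ x) := by
  rw [plug_gt]
  · congr 1; ext; simp only [Fin.lt_def, shift] at *; omega
  · simp only [Fin.lt_def, shift] at *; omega

/-! ### Bracket expressions

A formal expression made of iterated binary brackets in the symbols `x₀, …, xₖ₋₁` is an element of
`FreeMagma (Fin k)`; the product `a * b` is the formal bracket `[a, b]`. -/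

/-- The list of the indices of the symbols in an expression. -/
def leaves {α : Type*} : FreeMagma α → List α
  | .of x => [x]
  | .mul a b => leaves a ++ leaves b

/-- The list of all brackets `[a, b]` in an expression, the outer one included. -/
def brackets {α : Type*} : FreeMagma α → List (FreeMagma α)
  | .of _ => []
  | .mul a b => (a * b) :: (brackets a ++ brackets b)

/-- Each of the symbols `x₀, …, xₖ₋₁` appears exactly once. -/
def IsMultilinear {k : ℕ} (A : FreeMagma (Fin k)) : Prop :=
  ∀ i, (leaves A).count i = 1

/-- In every bracket `[a, b]` the smallest index appears in `a` and the largest in `b`. -/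
def IsOriented {α : Type*} [LinearOrder α] (A : FreeMagma α) : Prop :=
  ∀ a b : FreeMagma α, a * b ∈ brackets A →
    (∃ x ∈ leaves a, ∀ y ∈ leaves (a * b), x ≤ y) ∧ (∃ z ∈ leaves b, ∀ y ∈ leaves (a * b), y ≤ z)

/-- The composition `A ∘ᵢ B` of expressions. -/
def composeExpr {m n k : ℕ} (h : m + n = k + 1) (i : Fin m) (A : FreeMagma (Fin m))
    (B : FreeMagma (Fin n)) : FreeMagma (Fin k) :=
  FreeMagma.lift (plug h i FreeMagma.of (FreeMagma.map (shift h i) B)) A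

theorem leaves_of {α : Type*} (x : α) : leaves (FreeMagma.of x) = [x] := rfl

theorem leaves_mul {α : Type*} (a b : FreeMagma α) : leaves (a * b) = leaves a ++ leaves b := rfl

theorem brackets_of {α : Type*} (x : α) : brackets (FreeMagma.of x) = [] := rfl

theorem brackets_mul {α : Type*} (a b : FreeMagma α) :
    brackets (a * b) = (a * b) :: (brackets a ++ brackets b) := rfl

theorem freeMagma_mul_inj {α : Type*} {a b c d : FreeMagma α} (h : a * b = c * d) :
    a = c ∧ b = d := by
  change FreeMagma.mul a b = FreeMagma.mul c d at h
  exact FreeMagma.noConfusion rfl (heq_of_eq h) fun h₁ h₂ => ⟨eq_of_heq h₁, eq_of_heq h₂⟩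

theorem isOriented_of {α : Type*} [LinearOrder α] (x : α) : IsOriented (FreeMagma.of x) := by
  intro a b h; simp [brackets_of] at h

theorem isOriented_mul {α : Type*} [LinearOrder α] (a b : FreeMagma α) :
    IsOriented (a * b) ↔
      ((∃ x ∈ leaves a, ∀ y ∈ leaves (a * b), x ≤ y) ∧
        (∃ z ∈ leaves b, ∀ y ∈ leaves (a * b), y ≤ z)) ∧ IsOriented a ∧ IsOriented b := by
  constructor
  · intro h
    refine ⟨h a b (by simp [brackets_mul]), fun c d hcd => h c d ?_, fun c d hcd => h c d ?_⟩ <;>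
      simp [brackets_mul, hcd]
  · rintro ⟨h₀, h₁, h₂⟩ c d hcd
    rw [brackets_mul, List.mem_cons, List.mem_append] at hcd
    rcases hcd with h | h | h
    · obtain ⟨rfl, rfl⟩ := freeMagma_mul_inj h; exact h₀
    · exact h₁ c d h
    · exact h₂ c d h

theorem leaves_lift {α β : Type*} (σ : α → FreeMagma β) (A : FreeMagma α) :
    leaves (FreeMagma.lift σ A) = (leaves A).flatMap fun x => leaves (σ x) := by
  induction A with
  | ih1 x => simp [leaves_of]
  | ih2 a b ha hb => rw [map_mul, leaves_mul, leaves_mul, ha, hb, List.flatMap_append]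

theorem leaves_map {α β : Type*} (f : α → β) (A : FreeMagma α) :
    leaves (FreeMagma.map f A) = (leaves A).map f := by
  induction A with
  | ih1 x => rfl
  | ih2 a b ha hb => rw [map_mul, leaves_mul, leaves_mul, ha, hb, List.map_append]

theorem leaves_ne_nil {α : Type*} (A : FreeMagma α) : leaves A ≠ [] := by
  induction A with
  | ih1 x => simp [leaves_of]
  | ih2 a b ha hb => simp [leaves_mul, ha]

theorem exists_min_leaf {α : Type*} [LinearOrder α] (A : FreeMagma α) :
    ∃ x ∈ leaves A, ∀ y ∈ leaves A, x ≤ y := by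
  obtain ⟨x, hx, h⟩ := (leaves A).toFinset.exists_min_image id
    ((List.toFinset_nonempty_iff _).2 (leaves_ne_nil A))
  exact ⟨x, by simpa using hx, fun y hy => h y (by simpa using hy)⟩

theorem exists_max_leaf {α : Type*} [LinearOrder α] (A : FreeMagma α) :
    ∃ x ∈ leaves A, ∀ y ∈ leaves A, y ≤ x := by
  obtain ⟨x, hx, h⟩ := (leaves A).toFinset.exists_max_image id
    ((List.toFinset_nonempty_iff _).2 (leaves_ne_nil A))
  exact ⟨x, by simpa using hx, fun y hy => h y (by simpa using hy)⟩

theorem isOriented_lift {α β : Type*} [LinearOrder α] [LinearOrder β] (σ : α → FreeMagma β)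
    (hσ : ∀ x, IsOriented (σ x))
    (hlt : ∀ x y, x < y → ∀ u ∈ leaves (σ x), ∀ v ∈ leaves (σ y), u < v)
    (A : FreeMagma α) (hA : IsOriented A) : IsOriented (FreeMagma.lift σ A) := by
  induction A with
  | ih1 x => exact hσ x
  | ih2 a b ha hb =>
    rw [isOriented_mul] at hA
    obtain ⟨⟨⟨x, hx, hmin⟩, ⟨z, hz, hmax⟩⟩, h₁, h₂⟩ := hA
    rw [map_mul, isOriented_mul]
    refine ⟨⟨?_, ?_⟩, ha h₁, hb h₂⟩
    · obtain ⟨u, hu, hu'⟩ := exists_min_leaf (σ x)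
      refine ⟨u, by rw [leaves_lift]; exact List.mem_flatMap.2 ⟨x, hx, hu⟩, fun v hv => ?_⟩
      rw [← map_mul, leaves_lift] at hv
      obtain ⟨y, hy, hv⟩ := List.mem_flatMap.1 hv
      rcases (hmin y hy).lt_or_eq with h | rfl
      · exact (hlt x y h u hu v hv).le
      · exact hu' v hv
    · obtain ⟨u, hu, hu'⟩ := exists_max_leaf (σ z)
      refine ⟨u, by rw [leaves_lift]; exact List.mem_flatMap.2 ⟨z, hz, hu⟩, fun v hv => ?_⟩
      rw [← map_mul, leaves_lift] at hv
      obtain ⟨y, hy, hv⟩ := List.mem_flatMap.1 hv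
      rcases (hmax y hy).lt_or_eq with h | rfl
      · exact (hlt y z h v hv u hu).le
      · exact hu' v hv

theorem leaves_plug {m n k : ℕ} (h : m + n = k + 1) (i : Fin m) (B : FreeMagma (Fin n))
    (x : Fin m) :
    leaves (plug h i FreeMagma.of (FreeMagma.map (shift h i) B) x)
      = plug h i (fun y => [y]) ((leaves B).map (shift h i)) x := by
  rw [plug_comp h i _ _ leaves x, leaves_map]; rfl

theorem isOriented_composeExpr {m n k : ℕ} (h : m + n = k + 1) (i : Fin m)
    (A : FreeMagma (Fin m)) (B : FreeMagma (Fin n)) (hA : IsOriented A) (hB : IsOriented B) :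
    IsOriented (composeExpr h i A B) := by
  refine isOriented_lift _ (fun x => ?_) (fun x y hxy u hu v hv => ?_) A hA
  · rcases lt_trichotomy x i with hx | rfl | hx
    · rw [plug_lt _ _ _ _ _ hx]; exact isOriented_of _
    · rw [plug_self]
      refine isOriented_lift _ (fun x => isOriented_of _) (fun y z hyz u hu v hv => ?_) B hB
      simp only [Function.comp, leaves_of, List.mem_singleton] at hu hv
      subst hu hv
      simp only [Fin.lt_def, shift] at *; omega
    · rw [plug_gt _ _ _ _ _ hx]; exact isOriented_of _
  · rw [leaves_plug] at hu hv
    have key : ∀ (x : Fin m) (u : Fin k),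
        u ∈ plug h i (fun y => [y]) ((leaves B).map (shift h i)) x →
        (x < i ∧ u.1 = x) ∨ (x = i ∧ i.1 ≤ u ∧ u.1 < i + n) ∨ (i < x ∧ u.1 = x + n - 1) := by
      intro x u hu
      rcases lt_trichotomy x i with hx | rfl | hx
      · rw [plug_lt _ _ _ _ _ hx, List.mem_singleton] at hu
        exact Or.inl ⟨hx, congrArg Fin.val hu⟩
      · rw [plug_self, List.mem_map] at hu
        obtain ⟨b, -, rfl⟩ := hu
        refine Or.inr (Or.inl ⟨rfl, ?_, ?_⟩) <;> simp only [shift] <;> omega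
      · rw [plug_gt _ _ _ _ _ hx, List.mem_singleton] at hu
        exact Or.inr (Or.inr ⟨hx, congrArg Fin.val hu⟩)
    have hu := key x u hu
    have hv := key y v hv
    simp only [Fin.lt_def, Fin.ext_iff] at *
    omega

theorem IsMultilinear.perm {k : ℕ} {A : FreeMagma (Fin k)} (hA : IsMultilinear A) :
    (leaves A).Perm (List.finRange k) := by
  rw [List.perm_iff_count]
  intro x
  rw [hA x, List.count_eq_one_of_mem (List.nodup_finRange k) (List.mem_finRange x)]

theorem isMultilinear_composeExpr {m n k : ℕ} (h : m + n = k + 1) (i : Fin m)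
    (A : FreeMagma (Fin m)) (B : FreeMagma (Fin n)) (hA : IsMultilinear A)
    (hB : IsMultilinear B) : IsMultilinear (composeExpr h i A B) := by
  intro u
  rw [composeExpr, leaves_lift, (hA.perm.flatMap_right _).count_eq, List.count_flatMap]
  have hfin : ∀ f : Fin m → ℕ, ((List.finRange m).map f).sum = ∑ x, f x := fun f => by
    rw [← List.ofFn_eq_map, List.sum_ofFn]
  rw [hfin]
  simp only [Function.comp, leaves_plug]
  have key : ∃ x₀ : Fin m, ∀ x, List.count u
      (plug h i (fun y => [y]) ((leaves B).map (shift h i)) x) = if x = x₀ then 1 else 0 := by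
    have hinj : Function.Injective (shift h i) := by
      intro a b hab; simp only [shift, Fin.ext_iff] at *; omega
    have hcount : List.count u ((leaves B).map (shift h i)) =
        if i.1 ≤ u ∧ u.1 < i + n then 1 else 0 := by
      split_ifs with hu
      · have : u = shift h i ⟨u - i, by omega⟩ := by ext; simp only [shift]; omega
        rw [this, List.count_map_of_injective _ _ hinj, hB]
      · rw [List.count_eq_zero, List.mem_map]
        rintro ⟨b, -, rfl⟩
        apply hu; simp only [shift]; omega
    have hpl : ∀ x, List.count u
      (plug h i (fun y => [y]) ((leaves B).map (shift h i)) x) =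
        if (x.1 < i ∧ u.1 = x) ∨ (x.1 = i ∧ i.1 ≤ u ∧ u.1 < i + n) ∨ (i.1 < x ∧ u.1 = x + n - 1)
          then 1 else 0 := by
      intro x
      rcases lt_trichotomy x i with hx | rfl | hx
      · rw [plug_lt _ _ _ _ _ hx, List.count_singleton]
        simp only [Fin.lt_def, beq_iff_eq, Fin.ext_iff] at *
        split_ifs <;> first | rfl | omega
      · rw [plug_self, hcount]
        split_ifs <;> first | rfl | omega
      · rw [plug_gt _ _ _ _ _ hx, List.count_singleton]
        simp only [Fin.lt_def, beq_iff_eq, Fin.ext_iff] at *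
        split_ifs <;> first | rfl | omega
    refine ⟨⟨if u.1 < i then u else if u.1 < i + n then i else u + 1 - n, by split_ifs <;> omega⟩,
      fun x => ?_⟩
    rw [hpl]
    simp only [Fin.ext_iff]
    split_ifs <;> first | rfl | omega
  obtain ⟨x₀, hx₀⟩ := key
  simp [hx₀]

theorem freeMagma_map_shift_zero {n : ℕ} (h : 1 + n = n + 1) (B : FreeMagma (Fin n)) :
    FreeMagma.map (shift h 0) B = B := by
  induction B with
  | ih1 x => simp [shift]
  | ih2 a b ha hb => rw [map_mul, ha, hb]

theorem freeMagma_lift_congr {α β : Type*} {σ τ : α → FreeMagma β} (h : ∀ x, σ x = τ x)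
    (A : FreeMagma α) : FreeMagma.lift σ A = FreeMagma.lift τ A := by
  rw [funext h]

theorem freeMagma_lift_lift {α β γ : Type*} (τ : β → FreeMagma γ) (σ : α → FreeMagma β)
    (A : FreeMagma α) :
    FreeMagma.lift τ (FreeMagma.lift σ A) = FreeMagma.lift (fun x => FreeMagma.lift τ (σ x)) A := by
  induction A with
  | ih1 x => rfl
  | ih2 a b ha hb => simp only [map_mul, ha, hb]

theorem freeMagma_lift_of {α : Type*} (A : FreeMagma α) : FreeMagma.lift FreeMagma.of A = A := by
  induction A with
  | ih1 x => rfl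
  | ih2 a b ha hb => rw [map_mul, ha, hb]

/-- The operad `L`: `L(k)` is the set of the expressions in `k` symbols, each appearing exactly
once, such that the smallest (largest) index in every bracket is on the left (right). -/
def opL : NSOperad.{0} where
  obj k := {A : FreeMagma (Fin k) // IsMultilinear A ∧ IsOriented A}
  one := ⟨FreeMagma.of 0, fun i => by simp [leaves_of, Subsingleton.elim i 0], isOriented_of 0⟩
  circ h i A B := ⟨composeExpr h i A.1 B.1, isMultilinear_composeExpr h i _ _ A.2.1 B.2.1,
    isOriented_composeExpr h i _ _ A.2.2 B.2.2⟩
  one_circ h B := Subtype.ext <| by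
    simp only [composeExpr, FreeMagma.lift_of]
    rw [plug_self, freeMagma_map_shift_zero]
  circ_one h i A := Subtype.ext <| by
    simp only [composeExpr, FreeMagma.map_of]
    rw [freeMagma_lift_congr (plug_one h i FreeMagma.of), freeMagma_lift_of]
  circ_seq h₁ h₂ h₃ h₄ i j A B C := Subtype.ext <| by
    simp only [composeExpr]
    rw [freeMagma_lift_lift]
    refine freeMagma_lift_congr (fun x => plug_seq h₁ h₂ h₃ h₄ i j _ _ FreeMagma.of
      (FreeMagma.map (shift h₂ ⟨i + j, by omega⟩) C.1) _ (FreeMagma.lift _) ?_ ?_ x) _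
    · exact fun y => rfl
    · simp only [FreeMagma.map, freeMagma_lift_lift]
      refine freeMagma_lift_congr (fun x => ?_) _
      simp only [Function.comp, FreeMagma.lift_of]
      rw [plug_shift_seq h₁ h₂ h₃ h₄]
      refine Eq.trans ?_ (plug_comp h₃ j _ _ (FreeMagma.lift _) x).symm
      simp only [FreeMagma.lift_of, freeMagma_lift_lift, Function.comp_apply]
      congr 1
      refine freeMagma_lift_congr (fun x => ?_) _
      simp only [Function.comp, FreeMagma.lift_of]
      congr 1; ext; simp only [shift]; omega
  circ_par {m n p k q l} h₁ h₂ h₃ h₄ i j hij A B C := Subtype.ext <| by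
    simp only [composeExpr]
    rw [freeMagma_lift_lift, freeMagma_lift_lift]
    refine freeMagma_lift_congr (fun x => plug_par h₁ h₂ h₃ h₄ i j hij _ _ _ _ FreeMagma.of
      (FreeMagma.map (shift h₄ ⟨i, by omega⟩) B.1)
      (FreeMagma.map (shift h₂ ⟨j + n - 1, by omega⟩) C.1)
      (FreeMagma.lift _) (FreeMagma.lift _) (fun y => rfl) ?_ (fun y => rfl) ?_ x) _
    · simp only [FreeMagma.map, freeMagma_lift_lift]
      refine freeMagma_lift_congr (fun x => ?_) _
      simp only [Function.comp, FreeMagma.lift_of]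
      rw [plug_shift_par₁ h₁ h₂ h₃ h₄ i j hij]
    · simp only [FreeMagma.map, freeMagma_lift_lift]
      refine freeMagma_lift_congr (fun x => ?_) _
      simp only [Function.comp, FreeMagma.lift_of]
      rw [plug_shift_par₂ h₁ h₂ h₃ h₄ i j hij]

/-- A bracket is connected if the indices inside it form an interval of consecutive integers. -/
def IsConnectedBracket {k : ℕ} (b : FreeMagma (Fin k)) : Prop :=
  ∃ i j : Fin k, ∀ x, x ∈ leaves b ↔ i ≤ x ∧ x ≤ j

/-- An expression is prime if it has an outer bracket (it is not a single symbol), and that is the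
only connected bracket that it contains. -/
def IsPrimeExpr {k : ℕ} (A : FreeMagma (Fin k)) : Prop :=
  A ∈ brackets A ∧ ∀ b ∈ brackets A, IsConnectedBracket b ↔ b = A

/-- The set `P(k) ⊆ L(k)` of the prime expressions in `k` symbols. -/
def PrimeExpr (k : ℕ) : Type :=
  {A : opL.obj k // IsPrimeExpr A.1}

/-! ### The operad Lie -/

/-- The value of a formal bracket expression in the free Lie algebra. -/
noncomputable def toLie (R : Type*) [CommRing R] {α : Type*} : FreeMagma α → FreeLieAlgebra R α
  | .of x => FreeLieAlgebra.of R x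
  | .mul a b => ⁅toLie R a, toLie R b⁆

/-- `Lie(k)`: the submodule of the free Lie algebra on `k` generators that is spanned by the
iterated brackets in which each generator appears exactly once. -/
noncomputable def multilinearPart (R : Type*) [CommRing R] (k : ℕ) :
    Submodule R (FreeLieAlgebra R (Fin k)) :=
  Submodule.span R {f | ∃ A : FreeMagma (Fin k), IsMultilinear A ∧ toLie R A = f}

/-- The substitution of `g`, with its generators shifted, for the generator `xᵢ` of `f`. -/
noncomputable def composeLie {R : Type*} [CommRing R] {m n k : ℕ} (h : m + n = k + 1) (i : Fin m)
    (f : FreeLieAlgebra R (Fin m)) (g : FreeLieAlgebra R (Fin n)) : FreeLieAlgebra R (Fin k) :=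
  FreeLieAlgebra.lift R (plug h i (FreeLieAlgebra.of R)
    (FreeLieAlgebra.lift R (fun x => FreeLieAlgebra.of R (shift h i x)) g)) f

theorem toLie_of (R : Type*) [CommRing R] {α : Type*} (x : α) :
    toLie R (FreeMagma.of x) = FreeLieAlgebra.of R x := rfl

theorem toLie_mul (R : Type*) [CommRing R] {α : Type*} (a b : FreeMagma α) :
    toLie R (a * b) = ⁅toLie R a, toLie R b⁆ := rfl

theorem toLie_mem (R : Type*) [CommRing R] {k : ℕ} {A : FreeMagma (Fin k)}
    (hA : IsMultilinear A) : toLie R A ∈ multilinearPart R k :=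
  Submodule.subset_span ⟨A, hA, rfl⟩

theorem lift_toLie {R : Type*} [CommRing R] {α β : Type*} (σ : α → FreeMagma β)
    (A : FreeMagma α) :
    FreeLieAlgebra.lift R (fun x => toLie R (σ x)) (toLie R A)
      = toLie R (FreeMagma.lift σ A) := by
  induction A with
  | ih1 x => simp [toLie_of]
  | ih2 a b ha hb => rw [toLie_mul, LieHom.map_lie, ha, hb, map_mul, toLie_mul]

theorem composeLie_toLie {R : Type*} [CommRing R] {m n k : ℕ} (h : m + n = k + 1) (i : Fin m)
    (A : FreeMagma (Fin m)) (B : FreeMagma (Fin n)) :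
    composeLie h i (toLie R A) (toLie R B) = toLie R (composeExpr h i A B) := by
  rw [composeExpr, ← lift_toLie, composeLie]
  congr 2
  funext x
  rw [plug_comp h i _ _ (toLie R) x, FreeMagma.map, ← lift_toLie]; rfl

theorem composeLie_add_left {R : Type*} [CommRing R] {m n k : ℕ} (h : m + n = k + 1) (i : Fin m)
    (f f' : FreeLieAlgebra R (Fin m)) (g : FreeLieAlgebra R (Fin n)) :
    composeLie h i (f + f') g = composeLie h i f g + composeLie h i f' g :=
  map_add _ _ _

theorem composeLie_smul_left {R : Type*} [CommRing R] {m n k : ℕ} (h : m + n = k + 1) (i : Fin m)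
    (r : R) (f : FreeLieAlgebra R (Fin m)) (g : FreeLieAlgebra R (Fin n)) :
    composeLie h i (r • f) g = r • composeLie h i f g :=
  map_smul _ _ _

theorem composeLie_of {R : Type*} [CommRing R] {m n k : ℕ} (h : m + n = k + 1) (i x : Fin m)
    (g : FreeLieAlgebra R (Fin n)) :
    composeLie h i (FreeLieAlgebra.of R x) g = plug h i (FreeLieAlgebra.of R)
      (FreeLieAlgebra.lift R (fun x => FreeLieAlgebra.of R (shift h i x)) g) x := by
  simp [composeLie]

theorem composeLie_lie {R : Type*} [CommRing R] {m n k : ℕ} (h : m + n = k + 1) (i : Fin m)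
    (f f' : FreeLieAlgebra R (Fin m)) (g : FreeLieAlgebra R (Fin n)) :
    composeLie h i ⁅f, f'⁆ g = ⁅composeLie h i f g, composeLie h i f' g⁆ :=
  LieHom.map_lie _ _ _

theorem composeLie_const {R : Type*} [CommRing R] {m n k : ℕ} (h : m + n = k + 1) (i : Fin m)
    (A : FreeMagma (Fin m)) (hA : (leaves A).count i = 0) (g g' : FreeLieAlgebra R (Fin n)) :
    composeLie h i (toLie R A) g = composeLie h i (toLie R A) g' := by
  induction A with
  | ih1 x =>
    have hx : x ≠ i := by
      rintro rfl; simp [leaves_of] at hA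
    rw [toLie_of, composeLie_of, composeLie_of]
    rcases lt_or_gt_of_ne hx with hx | hx
    · rw [plug_lt _ _ _ _ _ hx, plug_lt _ _ _ _ _ hx]
    · rw [plug_gt _ _ _ _ _ hx, plug_gt _ _ _ _ _ hx]
  | ih2 a b ha hb =>
    rw [leaves_mul, List.count_append] at hA
    rw [toLie_mul, composeLie_lie, composeLie_lie, ha (by omega), hb (by omega)]

theorem composeLie_toLie_lin {R : Type*} [CommRing R] {m n k : ℕ} (h : m + n = k + 1) (i : Fin m)
    (A : FreeMagma (Fin m)) (hA : (leaves A).count i = 1) (r : R)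
    (g g' : FreeLieAlgebra R (Fin n)) :
    composeLie h i (toLie R A) (r • g + g')
      = r • composeLie h i (toLie R A) g + composeLie h i (toLie R A) g' := by
  induction A with
  | ih1 x =>
    have hx : x = i := by
      by_contra hx; simp [leaves_of, List.count_singleton, hx] at hA
    subst hx
    simp only [toLie_of, composeLie_of, plug_self, map_add, map_smul]
  | ih2 a b ha hb =>
    rw [leaves_mul, List.count_append] at hA
    simp only [toLie_mul, composeLie_lie]
    rcases Nat.eq_zero_or_pos ((leaves a).count i) with h₀ | h₀
    · rw [hb (by omega), composeLie_const h i a h₀ (r • g + g') g',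
        composeLie_const h i a h₀ g g', lie_add, lie_smul]
    · have h₁ : (leaves b).count i = 0 := by omega
      rw [ha (by omega), composeLie_const h i b h₁ (r • g + g') g',
        composeLie_const h i b h₁ g g', add_lie, smul_lie]

theorem composeLie_lin {R : Type*} [CommRing R] {m n k : ℕ} (h : m + n = k + 1) (i : Fin m)
    {f : FreeLieAlgebra R (Fin m)} (hf : f ∈ multilinearPart R m) (r : R)
    (g g' : FreeLieAlgebra R (Fin n)) :
    composeLie h i f (r • g + g') = r • composeLie h i f g + composeLie h i f g' := by
  induction hf using Submodule.span_induction with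
  | mem f hf => obtain ⟨A, hA, rfl⟩ := hf; exact composeLie_toLie_lin h i A (hA i) r g g'
  | zero => simp [composeLie]
  | add x y _ _ hx hy => simp only [composeLie_add_left, hx, hy, smul_add]; abel
  | smul a x _ hx => simp only [composeLie_smul_left, hx, smul_add, smul_comm a r]

theorem composeLie_add_right {R : Type*} [CommRing R] {m n k : ℕ} (h : m + n = k + 1) (i : Fin m)
    {f : FreeLieAlgebra R (Fin m)} (hf : f ∈ multilinearPart R m)
    (g g' : FreeLieAlgebra R (Fin n)) :
    composeLie h i f (g + g') = composeLie h i f g + composeLie h i f g' := by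
  simpa using composeLie_lin h i hf 1 g g'

theorem composeLie_zero_right {R : Type*} [CommRing R] {m n k : ℕ} (h : m + n = k + 1) (i : Fin m)
    {f : FreeLieAlgebra R (Fin m)} (hf : f ∈ multilinearPart R m) :
    composeLie h i f (0 : FreeLieAlgebra R (Fin n)) = 0 := by
  simpa using composeLie_add_right h i hf (0 : FreeLieAlgebra R (Fin n)) 0

theorem composeLie_smul_right {R : Type*} [CommRing R] {m n k : ℕ} (h : m + n = k + 1) (i : Fin m)
    {f : FreeLieAlgebra R (Fin m)} (hf : f ∈ multilinearPart R m) (r : R)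
    (g : FreeLieAlgebra R (Fin n)) :
    composeLie h i f (r • g) = r • composeLie h i f g := by
  simpa [composeLie_zero_right h i hf] using composeLie_lin h i hf r g 0

theorem composeLie_mem {R : Type*} [CommRing R] {m n k : ℕ} (h : m + n = k + 1) (i : Fin m)
    {f : FreeLieAlgebra R (Fin m)} (hf : f ∈ multilinearPart R m)
    {g : FreeLieAlgebra R (Fin n)} (hg : g ∈ multilinearPart R n) :
    composeLie h i f g ∈ multilinearPart R k := by
  have hf' := hf
  induction hf using Submodule.span_induction with
  | mem f hf =>
    obtain ⟨A, hA, rfl⟩ := hf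
    induction hg using Submodule.span_induction with
    | mem g hg =>
      obtain ⟨B, hB, rfl⟩ := hg
      rw [composeLie_toLie]
      exact toLie_mem R (isMultilinear_composeExpr h i A B hA hB)
    | zero => rw [composeLie_zero_right h i hf']; exact zero_mem _
    | add x y _ _ hx hy => rw [composeLie_add_right h i hf']; exact add_mem hx hy
    | smul a x _ hx => rw [composeLie_smul_right h i hf']; exact Submodule.smul_mem _ a hx
  | zero => simp [composeLie]
  | add x y hx' hy' hx hy => rw [composeLie_add_left]; exact add_mem (hx hx') (hy hy')
  | smul a x hx' hx => rw [composeLie_smul_left]; exact Submodule.smul_mem _ a (hx hx')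

theorem freeLie_lift_congr {R : Type*} [CommRing R] {α β : Type*} {σ τ : α → FreeLieAlgebra R β}
    (h : ∀ x, σ x = τ x) (f : FreeLieAlgebra R α) :
    FreeLieAlgebra.lift R σ f = FreeLieAlgebra.lift R τ f := by
  rw [funext h]

theorem freeLie_lift_lift {R : Type*} [CommRing R] {α β γ : Type*} (τ : β → FreeLieAlgebra R γ)
    (σ : α → FreeLieAlgebra R β) (f : FreeLieAlgebra R α) :
    FreeLieAlgebra.lift R τ (FreeLieAlgebra.lift R σ f)
      = FreeLieAlgebra.lift R (fun x => FreeLieAlgebra.lift R τ (σ x)) f := by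
  have : (FreeLieAlgebra.lift R τ).comp (FreeLieAlgebra.lift R σ)
      = FreeLieAlgebra.lift R (fun x => FreeLieAlgebra.lift R τ (σ x)) :=
    FreeLieAlgebra.hom_ext fun x => by simp
  exact DFunLike.congr_fun this f

theorem freeLie_lift_of {R : Type*} [CommRing R] {α : Type*} (f : FreeLieAlgebra R α) :
    FreeLieAlgebra.lift R (FreeLieAlgebra.of R) f = f := by
  have : FreeLieAlgebra.lift R (FreeLieAlgebra.of R (X := α)) = LieHom.id :=
    FreeLieAlgebra.hom_ext fun x => by simp
  exact DFunLike.congr_fun this f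

/-- The operad Lie over `R`, regarded as a non-symmetric operad. -/
noncomputable def opLie.{u} (R : Type u) [CommRing R] : LinNSOperad.{u, u} R where
  obj k := multilinearPart R k
  one := ⟨FreeLieAlgebra.of R 0, toLie_mem R opL.one.2.1⟩
  circ h i := LinearMap.mk₂ R (fun f g => ⟨composeLie h i f.1 g.1, composeLie_mem h i f.2 g.2⟩)
    (fun f f' g => Subtype.ext (composeLie_add_left h i f.1 f'.1 g.1))
    (fun r f g => Subtype.ext (composeLie_smul_left h i r f.1 g.1))
    (fun f g g' => Subtype.ext (composeLie_add_right h i f.2 g.1 g'.1))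
    (fun r f g => Subtype.ext (composeLie_smul_right h i f.2 r g.1))
  one_circ h g := Subtype.ext <| by
    simp only [LinearMap.mk₂_apply]
    rw [composeLie_of, plug_self]
    refine Eq.trans (freeLie_lift_congr (fun x => ?_) _) (freeLie_lift_of _)
    congr 1; ext; simp [shift]
  circ_one h i f := Subtype.ext <| by
    simp only [LinearMap.mk₂_apply, composeLie, FreeLieAlgebra.lift_of_apply]
    rw [freeLie_lift_congr (plug_one h i (FreeLieAlgebra.of R)), freeLie_lift_of]
  circ_seq h₁ h₂ h₃ h₄ i j f g e := Subtype.ext <| by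
    simp only [LinearMap.mk₂_apply, composeLie]
    rw [freeLie_lift_lift]
    refine freeLie_lift_congr (fun x => plug_seq h₁ h₂ h₃ h₄ i j _ _ (FreeLieAlgebra.of R)
      (FreeLieAlgebra.lift R (fun x => FreeLieAlgebra.of R (shift h₂ ⟨i + j, by omega⟩ x)) e.1) _
      (FreeLieAlgebra.lift R _) ?_ ?_ x) _
    · exact fun y => FreeLieAlgebra.lift_of_apply _ _
    · simp only [freeLie_lift_lift]
      refine freeLie_lift_congr (fun x => ?_) _
      simp only [FreeLieAlgebra.lift_of_apply]
      rw [plug_shift_seq h₁ h₂ h₃ h₄]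
      refine Eq.trans ?_ (plug_comp h₃ j _ _ (FreeLieAlgebra.lift R _) x).symm
      simp only [FreeLieAlgebra.lift_of_apply, freeLie_lift_lift]
      congr 1
      refine freeLie_lift_congr (fun x => ?_) _
      congr 1; ext; simp only [shift]; omega
  circ_par {m n p k q l} h₁ h₂ h₃ h₄ i j hij f g e := Subtype.ext <| by
    simp only [LinearMap.mk₂_apply, composeLie]
    rw [freeLie_lift_lift, freeLie_lift_lift]
    refine freeLie_lift_congr (fun x => plug_par h₁ h₂ h₃ h₄ i j hij _ _ _ _
      (FreeLieAlgebra.of R)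
      (FreeLieAlgebra.lift R (fun x => FreeLieAlgebra.of R (shift h₄ ⟨i, by omega⟩ x)) g.1)
      (FreeLieAlgebra.lift R
        (fun x => FreeLieAlgebra.of R (shift h₂ ⟨j + n - 1, by omega⟩ x)) e.1)
      (FreeLieAlgebra.lift R _) (FreeLieAlgebra.lift R _)
      (fun y => FreeLieAlgebra.lift_of_apply _ _) ?_
      (fun y => FreeLieAlgebra.lift_of_apply _ _) ?_ x) _
    · simp only [freeLie_lift_lift]
      refine freeLie_lift_congr (fun x => ?_) _
      simp only [FreeLieAlgebra.lift_of_apply]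
      rw [plug_shift_par₁ h₁ h₂ h₃ h₄ i j hij]
    · simp only [freeLie_lift_lift]
      refine freeLie_lift_congr (fun x => ?_) _
      simp only [FreeLieAlgebra.lift_of_apply]
      rw [plug_shift_par₂ h₁ h₂ h₃ h₄ i j hij]

/-- A formal expression of `L(k)`, read as an element of `Lie(k)`. -/
noncomputable def exprToLie.{u} (R : Type u) [CommRing R] {k : ℕ} (A : opL.obj k) :
    (opLie R).obj k :=
  ⟨toLie R A.1, toLie_mem R A.2.1⟩

universe u w₁ w₂

/-! Freeness of `L` is a diamond argument. In a multilinear expression, a connected bracket can be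
contracted to a single symbol, which writes the expression as `X ∘ᵢ B` with `B` the renumbered
bracket. If the bracket has as few symbols as possible, `B` is prime (`exists_decomp_opL`). Two
brackets are disjoint or nested (`brackets_laminar`), and nested copies of primes coincide. So two
splittings are equal, or contract disjoint brackets and are then related by the parallel axiom
(`decomp_opL_eq_or_parallel`). Any operad with such splittings is free
(`NSOperad.isFreeOn_of_decomp`): a morphism is defined by recursion on the arity, and its value does
not depend on the splitting chosen.

That `β` is onto is a rewriting argument: antisymmetry moves the smallest index to the left, and the
Jacobi identity then moves the largest one to the right (`toLie_mem_orientedSpan_of_nodup`).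

For injectivity, let `W` be the set of words in `k + 1` letters, each used once, that end in the
smallest letter. Reading the coefficients of the words of `W` maps the span of `L(k + 1)` onto
`R[W]`, since a right-normed bracket ending in the smallest letter contributes exactly one such
word. On the other hand, an oriented expression is encoded injectively by a word of `W`
(`endWords_injOn`), so the same span also embeds in `R[W]`. By Orzech's theorem, a surjection onto a
finitely generated module from a module that embeds in it is injective; hence so is evaluation
(`evalSpan_injective`). No cardinality is computed.

Finally, the span of a free operad in sets is free on the spans of the generators, and freeness is
transported along `β` (`LinNSOperad.isFreeOn_of_bijective`). -/

namespace NSOperad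

/-! ### A criterion for freeness of an operad in sets -/

/-- A decomposition of an operation as `Y ∘ᵢ x` with `x` one of the generators. -/
structure Decomp.{v} (O : NSOperad.{u}) {X : ℕ → Type v} (ι : ∀ n, X n → O.obj n) {k : ℕ}
    (A : O.obj k) where
  /-- the arity of the remaining operation -/
  m : ℕ
  /-- the arity of the generator -/
  n : ℕ
  h : m + n = k + 1
  /-- the input in which the generator is inserted -/
  i : Fin m
  /-- the remaining operation -/
  Y : O.obj m
  /-- the generator -/
  x : X n
  eq : O.circ h i Y (ι n x) = A

/-- The two generators are split off at different inputs `i < j` of a common operation. -/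
def Decomp.Parallel.{v} {O : NSOperad.{u}} {X : ℕ → Type v} {ι : ∀ n, X n → O.obj n} {k : ℕ}
    {A : O.obj k} (d d' : Decomp O ι A) : Prop :=
  ∃ (q : ℕ) (Z : O.obj q) (i j : Fin q) (_ : i < j) (h₁ : q + d.n = d'.m + 1)
    (h₃ : q + d'.n = d.m + 1),
    O.circ h₁ i Z (ι d.n d.x) = d'.Y ∧ O.circ h₃ j Z (ι d'.n d'.x) = d.Y ∧
      d.i.1 = i ∧ d'.i.1 = j + d.n - 1

theorem Hom.ext_map.{v} {O : NSOperad.{u}} {Q : NSOperad.{v}} {φ ψ : Hom O Q}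
    (h : ∀ n A, φ.map n A = ψ.map n A) : φ = ψ := by
  cases φ; cases ψ
  congr
  funext n A
  exact h n A

section Lift

universe w v
variable {O : NSOperad.{u}} {X : ℕ → Type v} {ι : ∀ n, X n → O.obj n}
  (hX : ∀ n, X n → 2 ≤ n) (hdec : ∀ k (A : O.obj k), k ≠ 1 → Nonempty (Decomp O ι A))
  (Q : NSOperad.{w}) (f : ∀ n, X n → Q.obj n)

/-- The extension of a map on generators to all operations, by repeatedly splitting off
generators. -/
noncomputable def liftMap (k : ℕ) (A : O.obj k) : Q.obj k :=
  if h : k = 1 then h ▸ Q.one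
  else
    let d := (hdec k A h).some
    have : d.m < k := by have := hX d.n d.x; have := d.h; omega
    Q.circ d.h d.i (liftMap d.m d.Y) (f d.n d.x)
termination_by k

theorem liftMap_one (A : O.obj 1) : liftMap hX hdec Q f 1 A = Q.one := by
  rw [liftMap]; simp

theorem Decomp.ne_one (hX : ∀ n, X n → 2 ≤ n) {k : ℕ} {A : O.obj k} (d : Decomp O ι A) :
    k ≠ 1 := by
  have := hX d.n d.x; have := d.h; have := d.i.2; omega

theorem Decomp.m_lt (hX : ∀ n, X n → 2 ≤ n) {k : ℕ} {A : O.obj k} (d : Decomp O ι A) :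
    d.m < k := by
  have := hX d.n d.x; have := d.h; omega

/-- Independence of the choices in the recursion. Splittings at two different generators can be
completed to a common operation `Z` of smaller arity, and the parallel axiom in `Q` closes the
diamond. -/
theorem liftMap_decomp
    (hdiam : ∀ k (A : O.obj k) (d d' : Decomp O ι A), d.i.1 ≤ d'.i.1 → d = d' ∨ d.Parallel d')
    (k : ℕ) : ∀ (A : O.obj k) (d : Decomp O ι A),
    liftMap hX hdec Q f k A = Q.circ d.h d.i (liftMap hX hdec Q f d.m d.Y) (f d.n d.x) := by
  induction k using Nat.strong_induction_on with
  | _ k ih =>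
  have par : ∀ (A : O.obj k) (d d' : Decomp O ι A), d.Parallel d' →
      Q.circ d.h d.i (liftMap hX hdec Q f d.m d.Y) (f d.n d.x) =
        Q.circ d'.h d'.i (liftMap hX hdec Q f d'.m d'.Y) (f d'.n d'.x) := by
    rintro A d d' ⟨q, Z, i, j, hij, h₁, h₃, e₁, e₃, ei, ej⟩
    -- Each remainder loses the generator split off by the other decomposition, so both sides are
    -- expressed through the value at `Z`.
    rw [ih d.m (d.m_lt hX) d.Y ⟨q, d'.n, h₃, j, Z, d'.x, e₃⟩,
      ih d'.m (d'.m_lt hX) d'.Y ⟨q, d.n, h₁, i, Z, d.x, e₁⟩]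
    have hi : d.i = ⟨i, by have := d.i.2; omega⟩ := Fin.ext ei
    have hj : d'.i = ⟨j + d.n - 1, by have := d'.i.2; omega⟩ := Fin.ext ej
    rw [hi, hj]
    exact (Q.circ_par h₁ d'.h h₃ d.h i j hij _ _ _).symm
  intro A d
  rw [liftMap, dif_neg (d.ne_one hX)]
  dsimp only
  rcases le_total (hdec k A (d.ne_one hX)).some.i.1 d.i.1 with h | h
  · rcases hdiam k A _ _ h with h | h
    · rw [h]
    · exact par A _ _ h
  · rcases hdiam k A _ _ h with h | h
    · rw [← h]
    · exact (par A _ _ h).symm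

/-- An operad is free on a family of generators of arity at least two if every operation that is
not the unit splits off a generator and any two such splittings are equal or parallel. -/
theorem isFreeOn_of_decomp (hX : ∀ n, X n → 2 ≤ n) (hone : ∀ A : O.obj 1, A = O.one)
    (hdec : ∀ k (A : O.obj k), k ≠ 1 → Nonempty (Decomp O ι A))
    (hdiam : ∀ k (A : O.obj k) (d d' : Decomp O ι A), d.i.1 ≤ d'.i.1 → d = d' ∨ d.Parallel d') :
    IsFreeOn.{w} O X ι := by
  intro Q f
  have key := liftMap_decomp hX hdec Q f hdiam
  refine ⟨⟨liftMap hX hdec Q f, liftMap_one hX hdec Q f O.one, ?_⟩, ?_, ?_⟩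
  · intro m n
    induction n using Nat.strong_induction_on with
    | _ n ih =>
    intro k h i A C
    by_cases hn : n = 1
    · subst hn
      obtain rfl : k = m := by omega
      rw [hone C, O.circ_one, liftMap_one, Q.circ_one]
    · obtain ⟨d⟩ := hdec n C hn
      have hd := d.h
      have hm := hX d.n d.x
      have h₁ : m + d.m = (m + d.m - 1) + 1 := by have := i.2; omega
      have h₂ : (m + d.m - 1) + d.n = k + 1 := by omega
      -- By the sequential axiom, a generator split off from `C` is also split off from `A ∘ᵢ C`,
      -- with remainder `A ∘ᵢ d.Y`; this permits induction on the arity of `C`.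
      have e : O.circ h i A C
          = O.circ h₂ ⟨i + d.i, by have := d.i.2; omega⟩ (O.circ h₁ i A d.Y) (ι d.n d.x) := by
        conv_lhs => rw [← d.eq]
        exact (O.circ_seq h₁ h₂ d.h h i d.i A d.Y _).symm
      rw [key n C d, key k _ ⟨_, _, h₂, _, _, d.x, e.symm⟩]
      dsimp only
      rw [ih d.m (d.m_lt hX)]
      exact Q.circ_seq h₁ h₂ d.h h i d.i _ _ _
  · intro n x
    have hn := hX n x
    dsimp only
    -- A generator is split off from itself with the unit as remainder.
    rw [key n _ ⟨1, n, by omega, 0, O.one, x, O.one_circ _ _⟩]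
    dsimp only
    rw [liftMap_one, Q.one_circ]
  · intro ψ hψ
    apply Hom.ext_map
    intro k
    induction k using Nat.strong_induction_on with
    | _ k ih =>
    intro A
    by_cases hk : k = 1
    · subst hk
      rw [hone A, ψ.map_one]
      exact (liftMap_one hX hdec Q f O.one).symm
    · obtain ⟨d⟩ := hdec k A hk
      have e := ih d.m (d.m_lt hX) d.Y
      dsimp only at e ⊢
      rw [key k A d, ← e, ← hψ, ← ψ.map_circ, d.eq]

end Lift

end NSOperad

/-! ### Brackets and substitution in formal expressions -/

section Brackets

variable {α β : Type*}

theorem mem_brackets_lift (σ : α → FreeMagma β) (A : FreeMagma α) (b : FreeMagma β) :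
    b ∈ brackets (FreeMagma.lift σ A) ↔
      (∃ a ∈ brackets A, FreeMagma.lift σ a = b) ∨ ∃ x ∈ leaves A, b ∈ brackets (σ x) := by
  induction A with
  | ih1 x => simp [brackets_of, leaves_of]
  | ih2 p q hp hq =>
    rw [map_mul, brackets_mul, brackets_mul, leaves_mul]
    simp only [List.mem_cons, List.mem_append, hp, hq, or_and_right, exists_or, exists_eq_left,
      map_mul]
    rw [or_or_or_comm, ← or_assoc, eq_comm (a := b)]

theorem mem_brackets_map (f : α → β) (A : FreeMagma α) (b : FreeMagma β) :
    b ∈ brackets (FreeMagma.map f A) ↔ ∃ a ∈ brackets A, FreeMagma.map f a = b := by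
  rw [FreeMagma.map, mem_brackets_lift]
  simp [brackets_of]

theorem mem_brackets_self_of_mem {A b : FreeMagma α} (h : b ∈ brackets A) : b ∈ brackets b := by
  induction A with
  | ih1 x => simp [brackets_of] at h
  | ih2 p q hp hq =>
    rw [brackets_mul, List.mem_cons, List.mem_append] at h
    rcases h with rfl | h | h
    · simp [brackets_mul]
    · exact hp h
    · exact hq h

theorem leaves_sublist {A b : FreeMagma α} (h : b ∈ brackets A) :
    (leaves b).Sublist (leaves A) := by
  induction A with
  | ih1 x => simp [brackets_of] at h
  | ih2 p q hp hq =>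
    rw [brackets_mul, List.mem_cons, List.mem_append] at h
    rw [leaves_mul]
    rcases h with rfl | h | h
    · rw [leaves_mul]
    · exact (hp h).trans (List.sublist_append_left _ _)
    · exact (hq h).trans (List.sublist_append_right _ _)

theorem length_leaves_pos (A : FreeMagma α) : 0 < (leaves A).length :=
  List.length_pos_iff.2 (leaves_ne_nil A)

theorem eq_or_length_lt {A b : FreeMagma α} (h : b ∈ brackets A) :
    b = A ∨ (leaves b).length < (leaves A).length := by
  cases A using FreeMagma.recOnMul with
  | ih1 x => simp [brackets_of] at h
  | ih2 p q =>
    rw [brackets_mul, List.mem_cons, List.mem_append] at h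
    rw [leaves_mul, List.length_append]
    have hp := length_leaves_pos p
    have hq := length_leaves_pos q
    rcases h with rfl | h | h
    · exact Or.inl rfl
    · have := (leaves_sublist h).length_le; right; omega
    · have := (leaves_sublist h).length_le; right; omega

/-- Two brackets in an expression without repeated symbols are disjoint or nested. -/
theorem brackets_laminar {A b c : FreeMagma α} (hA : (leaves A).Nodup) (hb : b ∈ brackets A)
    (hc : c ∈ brackets A) :
    (leaves b).Disjoint (leaves c) ∨ b ∈ brackets c ∨ c ∈ brackets b := by
  induction A with
  | ih1 x => simp [brackets_of] at hb
  | ih2 p q hp hq =>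
    rw [leaves_mul, List.nodup_append'] at hA
    obtain ⟨h₁, h₂, hd⟩ := hA
    have hb' := hb
    have hc' := hc
    rw [brackets_mul, List.mem_cons, List.mem_append] at hb hc
    rcases hb with rfl | hb | hb
    · exact Or.inr (Or.inr hc')
    · rcases hc with rfl | hc | hc
      · exact Or.inr (Or.inl hb')
      · exact hp h₁ hb hc
      · left
        intro x hx hx'
        exact hd ((leaves_sublist hb).subset hx) ((leaves_sublist hc).subset hx')
    · rcases hc with rfl | hc | hc
      · exact Or.inr (Or.inl hb')
      · left
        intro x hx hx'
        exact hd ((leaves_sublist hc).subset hx') ((leaves_sublist hb).subset hx)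
      · exact hq h₂ hb hc

/-- The blocks `σ x` have disjoint sets of symbols, so each block determines its index and the two
trees can be compared from the root. The one obstacle is a block that is itself the image of a
bracket, which `aux` excludes. -/
theorem lift_injOn {σ : α → FreeMagma β}
    (hσ : ∀ x y u, u ∈ leaves (σ x) → u ∈ leaves (σ y) → x = y) {A A' : FreeMagma α}
    (hA : (leaves A).Nodup) (hA' : (leaves A').Nodup)
    (h : FreeMagma.lift σ A = FreeMagma.lift σ A') : A = A' := by
  -- If a block equals the image of `p * q`, disjointness of blocks forces every symbol of `p * q`
  -- to be `x`, so `x` is repeated.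
  have aux : ∀ (x : α) (p q : FreeMagma α), (leaves (p * q)).Nodup →
      σ x ≠ FreeMagma.lift σ (p * q) := by
    intro x p q hpq h
    have hmem : ∀ y ∈ leaves (p * q), y = x := by
      intro y hy
      obtain ⟨u, hu⟩ := List.exists_mem_of_ne_nil _ (leaves_ne_nil (σ y))
      refine hσ y x u hu ?_
      rw [h, leaves_lift]
      exact List.mem_flatMap.2 ⟨y, hy, hu⟩
    obtain ⟨u, hu⟩ := List.exists_mem_of_ne_nil _ (leaves_ne_nil p)
    obtain ⟨v, hv⟩ := List.exists_mem_of_ne_nil _ (leaves_ne_nil q)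
    rw [leaves_mul] at hmem hpq
    have e := (hmem u (by simp [hu])).trans (hmem v (by simp [hv])).symm
    subst e
    exact (List.nodup_append'.1 hpq).2.2 hu hv
  induction A generalizing A' with
  | ih1 x =>
    cases A' using FreeMagma.recOnMul with
    | ih1 y =>
      obtain ⟨u, hu⟩ := List.exists_mem_of_ne_nil _ (leaves_ne_nil (σ x))
      have h' : σ x = σ y := h
      rw [hσ x y u hu (h' ▸ hu)]
    | ih2 p q => exact absurd h (aux x p q hA')
  | ih2 p q hp hq =>
    cases A' using FreeMagma.recOnMul with
    | ih1 y => exact absurd h.symm (aux y p q hA)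
    | ih2 p' q' =>
      rw [map_mul, map_mul] at h
      obtain ⟨e₁, e₂⟩ := freeMagma_mul_inj h
      rw [leaves_mul, List.nodup_append'] at hA hA'
      rw [hp hA.1 hA'.1 e₁, hq hA.2.1 hA'.2.1 e₂]

theorem map_injOn {f : α → β} (hf : Function.Injective f) {A A' : FreeMagma α}
    (hA : (leaves A).Nodup) (hA' : (leaves A').Nodup)
    (h : FreeMagma.map f A = FreeMagma.map f A') : A = A' := by
  refine lift_injOn (σ := FreeMagma.of ∘ f) (fun x y u hu hv => ?_) hA hA' h
  simp only [Function.comp, leaves_of, List.mem_singleton] at hu hv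
  exact hf (hu.symm.trans hv)

/-- An expression in which `b` occurs as a bracket is obtained by substituting `b` for a symbol. -/
theorem exists_lift_eq {σ : α → FreeMagma β} {y : α} {b : FreeMagma β} (hy : σ y = b)
    (hc : ∀ x, x ∉ leaves b → ∃ z, σ z = FreeMagma.of x) {S : FreeMagma β}
    (hS : (leaves S).Nodup) (h : b ∈ brackets S ∨ (leaves S).Disjoint (leaves b)) :
    ∃ X, FreeMagma.lift σ X = S := by
  induction S with
  | ih1 x =>
    rcases h with h | h
    · simp [brackets_of] at h
    · obtain ⟨z, hz⟩ := hc x fun hx => h (by simp [leaves_of]) hx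
      exact ⟨FreeMagma.of z, hz⟩
  | ih2 p q hp hq =>
    rw [leaves_mul] at h hS
    rw [List.nodup_append'] at hS
    obtain ⟨h₁, h₂, hd⟩ := hS
    rw [brackets_mul, List.mem_cons, List.mem_append] at h
    have glue : (∃ X, FreeMagma.lift σ X = p) → (∃ X, FreeMagma.lift σ X = q) →
        ∃ X, FreeMagma.lift σ X = p * q := by
      rintro ⟨X, rfl⟩ ⟨Y, rfl⟩
      exact ⟨X * Y, map_mul _ _ _⟩
    -- Descend towards `b`: it is the whole expression or lies in one factor, and the other factor
    -- is then disjoint from it because no symbol is repeated.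
    rcases h with (rfl | h | h) | h
    · exact ⟨FreeMagma.of y, hy⟩
    · exact glue (hp h₁ (Or.inl h)) (hq h₂ (Or.inr fun x hx hx' =>
        hd ((leaves_sublist h).subset hx') hx))
    · exact glue (hp h₁ (Or.inr fun x hx hx' =>
        hd hx ((leaves_sublist h).subset hx'))) (hq h₂ (Or.inl h))
    · rw [List.disjoint_append_left] at h
      exact glue (hp h₁ (Or.inr h.1)) (hq h₂ (Or.inr h.2))

/-- Blocks are ordered like their indices, so a smallest (largest) symbol of the image lies in the
block of a smallest (largest) index. -/
theorem isOriented_of_lift [LinearOrder α] [LinearOrder β] {σ : α → FreeMagma β}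
    (hlt : ∀ x y, x < y → ∀ u ∈ leaves (σ x), ∀ v ∈ leaves (σ y), u < v)
    {A : FreeMagma α} (hA : IsOriented (FreeMagma.lift σ A)) : IsOriented A := by
  induction A with
  | ih1 x => exact isOriented_of x
  | ih2 a b ha hb =>
    rw [map_mul, isOriented_mul] at hA
    obtain ⟨⟨⟨u, hu, hmin⟩, ⟨v, hv, hmax⟩⟩, h₁, h₂⟩ := hA
    rw [isOriented_mul]
    rw [← map_mul] at hmin hmax
    simp only [leaves_lift, List.mem_flatMap] at hu hv hmin hmax
    obtain ⟨x, hx, hu⟩ := hu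
    obtain ⟨z, hz, hv⟩ := hv
    refine ⟨⟨⟨x, hx, fun y hy => ?_⟩, z, hz, fun y hy => ?_⟩, ha h₁, hb h₂⟩
    · obtain ⟨w, hw⟩ := List.exists_mem_of_ne_nil _ (leaves_ne_nil (σ y))
      by_contra hlt'
      exact absurd (hmin w ⟨y, hy, hw⟩) (not_le.2 (hlt y x (not_le.1 hlt') w hw u hu))
    · obtain ⟨w, hw⟩ := List.exists_mem_of_ne_nil _ (leaves_ne_nil (σ y))
      by_contra hlt'
      exact absurd (hmax w ⟨y, hy, hw⟩) (not_le.2 (hlt z y (not_le.1 hlt') v hv w hw))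

theorem IsOriented.of_mem_brackets [LinearOrder α] {A b : FreeMagma α} (hA : IsOriented A)
    (h : b ∈ brackets A) : IsOriented b := by
  induction A with
  | ih1 x => simp [brackets_of] at h
  | ih2 p q hp hq =>
    rw [brackets_mul, List.mem_cons, List.mem_append] at h
    rcases h with rfl | h | h
    · exact hA
    · exact hp ((isOriented_mul p q).1 hA).2.1 h
    · exact hq ((isOriented_mul p q).1 hA).2.2 h

end Brackets

/-! ### Splitting off connected brackets -/

theorem isMultilinear_iff {k : ℕ} {A : FreeMagma (Fin k)} :
    IsMultilinear A ↔ (leaves A).Nodup ∧ ∀ x, x ∈ leaves A := by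
  constructor
  · intro h
    exact ⟨List.nodup_iff_count_le_one.2 fun x => (h x).le,
      fun x => List.count_pos_iff.1 (by rw [h x]; exact one_pos)⟩
  · rintro ⟨h₁, h₂⟩ x
    exact List.count_eq_one_of_mem h₁ (h₂ x)

theorem IsMultilinear.nodup {k : ℕ} {A : FreeMagma (Fin k)} (hA : IsMultilinear A) :
    (leaves A).Nodup :=
  (isMultilinear_iff.1 hA).1

theorem IsMultilinear.mem {k : ℕ} {A : FreeMagma (Fin k)} (hA : IsMultilinear A) (x : Fin k) :
    x ∈ leaves A :=
  (isMultilinear_iff.1 hA).2 x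

theorem IsMultilinear.length {k : ℕ} {A : FreeMagma (Fin k)} (hA : IsMultilinear A) :
    (leaves A).length = k := by
  rw [hA.perm.length_eq, List.length_finRange]

theorem shift_injective {m n k : ℕ} (h : m + n = k + 1) (i : Fin m) :
    Function.Injective (shift h i) := by
  intro a b hab
  simp only [shift, Fin.ext_iff] at *
  omega

theorem mem_leaves_map_shift {m n k : ℕ} (h : m + n = k + 1) (i : Fin m) {B : FreeMagma (Fin n)}
    (hB : IsMultilinear B) (x : Fin k) :
    x ∈ leaves (FreeMagma.map (shift h i) B) ↔ i.1 ≤ x ∧ x.1 < i + n := by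
  rw [leaves_map, List.mem_map]
  constructor
  · rintro ⟨y, -, rfl⟩
    simp only [shift]; omega
  · rintro ⟨h₁, h₂⟩
    exact ⟨⟨x - i, by omega⟩, hB.mem _, by ext; simp only [shift]; omega⟩

theorem mem_leaves_plug {m n k : ℕ} (h : m + n = k + 1) (i : Fin m) {b : FreeMagma (Fin k)}
    (hb : ∀ x, x ∈ leaves b ↔ i.1 ≤ x.1 ∧ x.1 < i + n) (x : Fin m) (u : Fin k) :
    u ∈ leaves (plug h i FreeMagma.of b x) ↔
      (x < i ∧ u.1 = x) ∨ (x = i ∧ i.1 ≤ u ∧ u.1 < i + n) ∨ (i < x ∧ u.1 = x + n - 1) := by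
  rcases lt_trichotomy x i with hx | rfl | hx
  · rw [plug_lt _ _ _ _ _ hx, leaves_of, List.mem_singleton]
    simp only [Fin.lt_def, Fin.ext_iff] at *; omega
  · rw [plug_self, hb]
    simp
  · rw [plug_gt _ _ _ _ _ hx, leaves_of, List.mem_singleton]
    simp only [Fin.lt_def, Fin.ext_iff] at *; omega

theorem leaves_plug_lt {m n k : ℕ} (h : m + n = k + 1) (i : Fin m) {b : FreeMagma (Fin k)}
    (hb : ∀ x, x ∈ leaves b ↔ i.1 ≤ x.1 ∧ x.1 < i + n) (x y : Fin m) (hxy : x < y) (u : Fin k)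
    (hu : u ∈ leaves (plug h i FreeMagma.of b x)) (v : Fin k)
    (hv : v ∈ leaves (plug h i FreeMagma.of b y)) : u < v := by
  rw [mem_leaves_plug h i hb] at hu hv
  simp only [Fin.lt_def, Fin.ext_iff] at *
  omega

theorem leaves_plug_inj {m n k : ℕ} (h : m + n = k + 1) (i : Fin m) {b : FreeMagma (Fin k)}
    (hb : ∀ x, x ∈ leaves b ↔ i.1 ≤ x.1 ∧ x.1 < i + n) (x y : Fin m) (u : Fin k)
    (hu : u ∈ leaves (plug h i FreeMagma.of b x))
    (hv : u ∈ leaves (plug h i FreeMagma.of b y)) : x = y := by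
  rw [mem_leaves_plug h i hb] at hu hv
  simp only [Fin.lt_def, Fin.ext_iff] at *
  omega

theorem map_shift_mem_brackets {m n k : ℕ} (h : m + n = k + 1) (i : Fin m) (X : opL.obj m)
    {B : FreeMagma (Fin n)} (hB : B ∈ brackets B) :
    FreeMagma.map (shift h i) B ∈ brackets (composeExpr h i X.1 B) := by
  rw [composeExpr, mem_brackets_lift]
  right
  refine ⟨i, X.2.1.mem i, ?_⟩
  rw [plug_self, mem_brackets_map]
  exact ⟨B, hB, rfl⟩

theorem composeExpr_left_cancel {m n k : ℕ} (h : m + n = k + 1) (i : Fin m) {X X' : opL.obj m}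
    {B : opL.obj n} (e : opL.circ h i X B = opL.circ h i X' B) : X = X' :=
  Subtype.ext (lift_injOn (leaves_plug_inj h i (mem_leaves_map_shift h i B.2.1))
    X.2.1.nodup X'.2.1.nodup (congrArg Subtype.val e))

/-- A bracket whose symbols form an interval can be split off from an expression in `L(k)`. -/
theorem exists_circ_eq {k : ℕ} (T : opL.obj k) {b : FreeMagma (Fin k)} (hb : b ∈ brackets T.1)
    (i n : ℕ) (hleaves : ∀ x : Fin k, x ∈ leaves b ↔ i ≤ x.1 ∧ x.1 < i + n) (hin : i + n ≤ k) :
    ∃ (m : ℕ) (h : m + n = k + 1) (hi : i < m) (X : opL.obj m) (B : opL.obj n),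
      opL.circ h ⟨i, hi⟩ X B = T ∧ FreeMagma.map (shift h ⟨i, hi⟩) B.1 = b := by
  have hn : 0 < n := by
    obtain ⟨u, hu⟩ := List.exists_mem_of_ne_nil _ (leaves_ne_nil b)
    rw [hleaves] at hu; omega
  -- Contracting `n` symbols to one leaves `k + 1 - n` inputs.
  have h : (k + 1 - n) + n = k + 1 := by omega
  have hi : i < k + 1 - n := by omega
  obtain ⟨B, hB⟩ : ∃ B : FreeMagma (Fin n), FreeMagma.map (shift h ⟨i, hi⟩) B = b := by
    clear hb
    have : ∀ x ∈ leaves b, i ≤ x.1 ∧ x.1 < i + n := fun x hx => (hleaves x).1 hx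
    clear hleaves
    induction b with
    | ih1 x =>
      have := this x (by simp [leaves_of])
      exact ⟨FreeMagma.of ⟨x - i, by omega⟩, by
        simp only [FreeMagma.map_of, shift]; congr 1; ext; simp only; omega⟩
    | ih2 p q hp hq =>
      obtain ⟨P, rfl⟩ := hp fun x hx => this x (by simp [leaves_mul, hx])
      obtain ⟨Q, rfl⟩ := hq fun x hx => this x (by simp [leaves_mul, hx])
      exact ⟨P * Q, map_mul _ _ _⟩
  obtain ⟨X, hX⟩ := exists_lift_eq (σ := plug h ⟨i, hi⟩ FreeMagma.of b) (y := ⟨i, hi⟩)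
    (plug_self _ _ _ _) (fun x hx => by
      rw [hleaves] at hx
      by_cases hxi : x.1 < i
      · exact ⟨⟨x, by omega⟩, plug_lt h _ _ _ _ hxi⟩
      · refine ⟨⟨x + 1 - n, by omega⟩, ?_⟩
        rw [plug_gt h _ _ _ _ (by simp only [Fin.lt_def]; omega)]
        congr 1; ext; simp only; omega) T.2.1.nodup (Or.inl hb)
  have hlt := leaves_plug_lt h ⟨i, hi⟩ hleaves
  have hinj := leaves_plug_inj h ⟨i, hi⟩ hleaves
  refine ⟨k + 1 - n, h, hi, ⟨X, ?_, ?_⟩, ⟨B, ?_, ?_⟩, Subtype.ext ?_, hB⟩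
  · have hT := T.2.1
    rw [← hX, isMultilinear_iff, leaves_lift] at hT
    rw [isMultilinear_iff]
    constructor
    -- A repetition in `X` would repeat a whole nonempty block in `T`.
    · have := (List.nodup_flatMap.1 hT.1).2
      refine this.imp fun {x y} hxy hxy' => ?_
      subst hxy'
      obtain ⟨u, hu⟩ := List.exists_mem_of_ne_nil _
        (leaves_ne_nil (plug h ⟨i, hi⟩ FreeMagma.of b x))
      exact hxy hu hu
    · intro x
      obtain ⟨u, hu⟩ := List.exists_mem_of_ne_nil _
        (leaves_ne_nil (plug h ⟨i, hi⟩ FreeMagma.of b x))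
      obtain ⟨y, hy, hu'⟩ := List.mem_flatMap.1 (hT.2 u)
      rwa [hinj x y u hu hu']
  · exact isOriented_of_lift hlt (hX ▸ T.2.2)
  · rw [isMultilinear_iff]
    constructor
    · refine List.Nodup.of_map (shift h ⟨i, hi⟩) ?_
      rw [← leaves_map, hB]
      exact T.2.1.nodup.sublist (leaves_sublist hb)
    · intro x
      have : shift h ⟨i, hi⟩ x ∈ leaves b := by
        rw [hleaves]; simp only [shift]; omega
      rw [← hB, leaves_map, List.mem_map] at this
      obtain ⟨y, hy, e⟩ := this
      rwa [← shift_injective h _ e]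
  · refine isOriented_of_lift (σ := FreeMagma.of ∘ shift h ⟨i, hi⟩) (fun x y hxy u hu v hv => ?_)
      (show IsOriented (FreeMagma.map (shift h ⟨i, hi⟩) B) from hB ▸ T.2.2.of_mem_brackets hb)
    simp only [Function.comp, leaves_of, List.mem_singleton] at hu hv
    subst hu hv
    simp only [Fin.lt_def, shift] at *; omega
  · change FreeMagma.lift (plug h ⟨i, hi⟩ FreeMagma.of (FreeMagma.map _ B)) X = T.1
    rw [hB, hX]

/-- An interval given by its start and length matches the input and the arity of a partial
composition. The bound `i + n ≤ k` makes `n` the true number of symbols. -/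
theorem isConnectedBracket_iff {k : ℕ} {b : FreeMagma (Fin k)} :
    IsConnectedBracket b ↔
      ∃ i n : ℕ, i + n ≤ k ∧ ∀ x : Fin k, x ∈ leaves b ↔ i ≤ x.1 ∧ x.1 < i + n := by
  obtain ⟨u, hu⟩ := List.exists_mem_of_ne_nil _ (leaves_ne_nil b)
  constructor
  · rintro ⟨i, j, h⟩
    have := (h u).1 hu
    simp only [Fin.le_def] at h this
    exact ⟨i, j + 1 - i, by omega, fun x => by rw [h]; omega⟩
  · rintro ⟨i, n, hin, h⟩
    have := (h u).1 hu
    exact ⟨⟨i, by omega⟩, ⟨i + n - 1, by omega⟩, fun x => by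
      rw [h]; simp only [Fin.le_def]; omega⟩

/-- The shift identifies `Fin n` with an interval, so intervals correspond to intervals. Hence
primality of `B` can be tested on its copy inside a larger expression. -/
theorem isConnectedBracket_map_shift_iff {m n k : ℕ} (h : m + n = k + 1) (i : Fin m)
    {B : FreeMagma (Fin n)} :
    IsConnectedBracket (FreeMagma.map (shift h i) B) ↔ IsConnectedBracket B := by
  simp only [isConnectedBracket_iff]
  obtain ⟨u, hu⟩ := List.exists_mem_of_ne_nil _ (leaves_ne_nil B)
  constructor
  · rintro ⟨j, p, hjp, hx⟩
    have hmem : ∀ x : Fin k, j ≤ x.1 ∧ x.1 < j + p → i.1 ≤ x.1 ∧ x.1 < i.1 + n := by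
      intro x h'
      rw [← hx, leaves_map, List.mem_map] at h'
      obtain ⟨y, -, rfl⟩ := h'
      simp only [shift]; omega
    have hp : j ≤ (shift h i u).1 ∧ (shift h i u).1 < j + p := by
      rw [← hx, leaves_map]; exact List.mem_map_of_mem hu
    have h₁ := hmem ⟨j, by omega⟩ (by simp only; omega)
    have h₂ := hmem ⟨j + p - 1, by omega⟩ (by simp only; omega)
    simp only at h₁ h₂
    refine ⟨j - i, p, by omega, fun y => ?_⟩
    have := hx (shift h i y)
    rw [leaves_map, List.mem_map_of_injective (shift_injective h i)] at this
    rw [this]; simp only [shift]; omega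
  · rintro ⟨j, p, hjp, hx⟩
    refine ⟨i + j, p, by omega, fun x => ?_⟩
    rw [leaves_map, List.mem_map]
    constructor
    · rintro ⟨y, hy, rfl⟩
      rw [hx] at hy; simp only [shift]; omega
    · intro h'
      exact ⟨⟨x - i, by omega⟩, (hx _).2 (by simp only; omega), by
        ext; simp only [shift]; omega⟩

theorem IsMultilinear.isConnectedBracket {k : ℕ} {A : FreeMagma (Fin k)} (hA : IsMultilinear A) :
    IsConnectedBracket A :=
  isConnectedBracket_iff.2 ⟨0, k, by omega, fun x => by simp [hA.mem x]⟩

theorem two_le_of_prime {n : ℕ} (p : PrimeExpr n) : 2 ≤ n := by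
  obtain ⟨⟨A, hA, hA'⟩, hp, -⟩ := p
  rw [← hA.length]
  cases A using FreeMagma.recOnMul with
  | ih1 x => simp [brackets_of] at hp
  | ih2 a b =>
    rw [leaves_mul, List.length_append]
    have := length_leaves_pos a
    have := length_leaves_pos b
    omega

/-- In an expression obtained by inserting a prime expression `B`, the only connected bracket
inside of the copy of `B` is that copy. -/
theorem PrimeExpr.eq_of_mem_brackets {m n k : ℕ} (h : m + n = k + 1) (i : Fin m)
    (B : PrimeExpr n) {c : FreeMagma (Fin k)} (hc : c ∈ brackets (FreeMagma.map (shift h i) B.1.1))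
    (hc' : IsConnectedBracket c) : c = FreeMagma.map (shift h i) B.1.1 := by
  obtain ⟨a, ha, rfl⟩ := (mem_brackets_map _ _ _).1 hc
  rw [(B.2.2 a ha).1 ((isConnectedBracket_map_shift_iff h i).1 hc')]

/-! ### Freeness of the operad `L` on prime expressions -/

theorem opL_one_unique (A : opL.obj 1) : A = opL.one := by
  obtain ⟨A, hA, hA'⟩ := A
  apply Subtype.ext
  have hl := hA.length
  cases A using FreeMagma.recOnMul with
  | ih1 x => exact congrArg FreeMagma.of (Subsingleton.elim x 0)
  | ih2 a b =>
    rw [leaves_mul, List.length_append] at hl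
    have := length_leaves_pos a
    have := length_leaves_pos b
    omega

/-- Split off a connected bracket with the fewest symbols; the whole expression is connected, so
there is one. A smaller connected bracket inside it would contradict minimality, which is primality.
-/
theorem exists_decomp_opL (k : ℕ) (A : opL.obj k) (hk : k ≠ 1) :
    Nonempty (NSOperad.Decomp opL (fun _ (p : PrimeExpr _) => p.1) A) := by
  have hself : A.1 ∈ brackets A.1 := by
    have hl := A.2.1.length
    rcases hA : A.1 with x | ⟨a, b⟩
    · rw [hA] at hl
      exact absurd hl.symm hk
    · exact List.mem_cons_self
  obtain ⟨b, ⟨hb, hb'⟩, hmin⟩ := (measure fun b : FreeMagma (Fin k) => (leaves b).length).wf.has_min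
    {b | b ∈ brackets A.1 ∧ IsConnectedBracket b} ⟨A.1, hself, A.2.1.isConnectedBracket⟩
  obtain ⟨i, n, hin, hleaves⟩ := isConnectedBracket_iff.1 hb'
  obtain ⟨m, h, hi, X, B, hXB, hB⟩ := exists_circ_eq A hb i n hleaves hin
  refine ⟨⟨m, n, h, ⟨i, hi⟩, X, ⟨B, ?_, fun c hc => ⟨fun hc' => ?_, ?_⟩⟩, hXB⟩⟩
  · have hbb := mem_brackets_self_of_mem hb
    rcases hB' : B.1 with x | ⟨p, q⟩
    · rw [hB'] at hB
      rw [← hB] at hbb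
      exact absurd hbb List.not_mem_nil
    · exact List.mem_cons_self
  · have hc₁ : FreeMagma.map (shift h ⟨i, hi⟩) c ∈ brackets b := by
      rw [← hB, mem_brackets_map]; exact ⟨c, hc, rfl⟩
    have hc₂ : FreeMagma.map (shift h ⟨i, hi⟩) c ∈ brackets A.1 := by
      rw [← hXB]
      change _ ∈ brackets (composeExpr h ⟨i, hi⟩ X.1 B.1)
      rw [composeExpr, mem_brackets_lift]
      right
      refine ⟨⟨i, hi⟩, X.2.1.mem _, ?_⟩
      rwa [plug_self, hB]
    have := hmin _ ⟨hc₂, (isConnectedBracket_map_shift_iff h _).2 hc'⟩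
    rcases eq_or_length_lt hc with e | e
    · exact e
    · refine absurd ?_ this
      change (leaves _).length < (leaves b).length
      rwa [← hB, leaves_map, leaves_map, List.length_map, List.length_map]
  · rintro rfl
    exact B.2.1.isConnectedBracket

/-- The copies of the two primes are connected brackets of `A`. If one contains the other, primality
makes them equal; if they are disjoint, both can be contracted. -/
theorem decomp_opL_eq_or_parallel (k : ℕ) (A : opL.obj k)
    (d d' : NSOperad.Decomp opL (fun _ (p : PrimeExpr _) => p.1) A) (hle : d.i.1 ≤ d'.i.1) :
    d = d' ∨ d.Parallel d' := by
  obtain ⟨m, n, h, i, Y, B, e⟩ := d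
  obtain ⟨m', n', h', i', Y', B', e'⟩ := d'
  dsimp only at e e' hle
  have hb : FreeMagma.map (shift h i) B.1.1 ∈ brackets A.1 := by
    rw [← e]; exact map_shift_mem_brackets h i Y B.2.1
  have hc : FreeMagma.map (shift h' i') B'.1.1 ∈ brackets A.1 := by
    rw [← e']; exact map_shift_mem_brackets h' i' Y' B'.2.1
  have lb := mem_leaves_map_shift h i B.1.2.1
  have lc := mem_leaves_map_shift h' i' B'.1.2.1
  have hn := two_le_of_prime B
  have hn' := two_le_of_prime B'
  have same : FreeMagma.map (shift h i) B.1.1 = FreeMagma.map (shift h' i') B'.1.1 →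
      (⟨m, n, h, i, Y, B, e⟩ : NSOperad.Decomp opL (fun _ (p : PrimeExpr _) => p.1) A)
        = ⟨m', n', h', i', Y', B', e'⟩ := by
    intro hbc
    -- Comparing the endpoints of the two intervals gives `i = i'` and `n = n'`.
    rw [← hbc] at lc
    have h₁ := (lc ⟨i, by omega⟩).1 ((lb _).2 (by simp only; omega))
    have h₂ := (lc ⟨i + n - 1, by omega⟩).1 ((lb _).2 (by simp only; omega))
    have h₃ := (lb ⟨i', by omega⟩).1 ((lc _).2 (by simp only; omega))
    have h₄ := (lb ⟨i' + n' - 1, by omega⟩).1 ((lc _).2 (by simp only; omega))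
    simp only at h₁ h₂ h₃ h₄
    obtain rfl : n = n' := by omega
    obtain rfl : m = m' := by omega
    obtain rfl : i = i' := Fin.ext (by omega)
    obtain rfl : B = B' := Subtype.ext (Subtype.ext
      (map_injOn (shift_injective h i) B.1.2.1.nodup B'.1.2.1.nodup hbc))
    obtain rfl : Y = Y' := composeExpr_left_cancel h i (e.trans e'.symm)
    rfl
  rcases brackets_laminar A.2.1.nodup hb hc with hd | hd | hd
  · right
    -- Otherwise `i'` would belong to both intervals, since `i ≤ i'`.
    have hlt : i.1 + n ≤ i' := by
      by_contra hlt
      exact hd ((lb ⟨i', by omega⟩).2 (by simp only; omega)) ((lc _).2 (by simp only; omega))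
    have hc' := hc
    rw [← e] at hc'
    change _ ∈ brackets (composeExpr h i Y.1 B.1.1) at hc'
    rw [composeExpr, mem_brackets_lift] at hc'
    have hmem := mem_leaves_plug h i lb
    rcases hc' with ⟨a, ha, hac⟩ | ⟨x, -, hx⟩
    -- The copy of `B'` comes from a bracket `a` of `Y`. Contracting the `n` symbols of `B`, all to
    -- its left, moves its first index from `i'` to `i' + 1 - n`.
    · have la : ∀ x : Fin m, x ∈ leaves a ↔ i' + 1 - n ≤ x.1 ∧ x.1 < i' + 1 - n + n' := by
        intro x
        have hxu : ∀ u, u ∈ leaves (plug h i FreeMagma.of (FreeMagma.map (shift h i) B.1.1) x) →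
            (x ∈ leaves a ↔ i'.1 ≤ u ∧ u.1 < i' + n') := by
          intro u hu
          rw [← lc, ← hac, leaves_lift, List.mem_flatMap]
          refine ⟨fun hx => ⟨x, hx, hu⟩, ?_⟩
          rintro ⟨y, hy, hu'⟩
          rwa [leaves_plug_inj h i lb x y u hu hu']
        obtain ⟨u, hu⟩ := List.exists_mem_of_ne_nil _
          (leaves_ne_nil (plug h i FreeMagma.of (FreeMagma.map (shift h i) B.1.1) x))
        rw [hxu u hu]
        rw [hmem] at hu
        simp only [Fin.lt_def, Fin.ext_iff] at hu
        omega
      obtain ⟨q, hq, hj, Z, C, hZ, hC⟩ := exists_circ_eq Y ha _ n' la (by omega)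
      have hCB : C = B'.1 := by
        apply Subtype.ext
        refine map_injOn (shift_injective h' i') C.2.1.nodup B'.1.2.1.nodup ?_
        rw [← hac, ← hC]
        refine Eq.trans ?_ (freeMagma_lift_lift _ _ _).symm
        refine freeMagma_lift_congr (fun x => ?_) _
        rw [Function.comp, Function.comp, FreeMagma.lift_of, plug_gt]
        · congr 1; ext; simp only [shift]; omega
        · simp only [Fin.lt_def, shift]; omega
      subst hCB
      have hij : (⟨i, by omega⟩ : Fin q) < ⟨i' + 1 - n, hj⟩ := by
        simp only [Fin.lt_def]; omega
      refine ⟨q, Z, ⟨i, by omega⟩, ⟨i' + 1 - n, hj⟩, hij, show q + n = m' + 1 by omega, hq,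
        ?_, hZ, rfl, ?_⟩
      -- Inserting `B'` on either side gives `A`, by the parallel axiom in `L`; `B'` is then
      -- cancelled.
      · refine composeExpr_left_cancel h' i' (B := B'.1) (Eq.trans ?_ e'.symm)
        have hi' : i' = ⟨i' + 1 - n + n - 1, by omega⟩ := Fin.ext (by simp only; omega)
        refine Eq.trans ?_ ((opL.circ_par (show q + n = m' + 1 by omega) h' hq h _ _ hij
          Z B.1 B'.1).trans ((congrArg (fun W => opL.circ h i W B.1) hZ).trans e))
        exact congrArg (fun t => opL.circ h' t _ B'.1) hi'
      · simp only; omega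
    -- A bracket inside a substituted block must lie in the copy of `B`, as the other blocks are
    -- single symbols; but that copy is disjoint from the copy of `B'`.
    · exfalso
      obtain ⟨u, hu⟩ := List.exists_mem_of_ne_nil _
        (leaves_ne_nil (FreeMagma.map (shift h' i') B'.1.1))
      have := (leaves_sublist hx).subset hu
      rw [lc] at hu
      rcases lt_trichotomy x i with hxi | rfl | hxi
      · rw [plug_lt _ _ _ _ _ hxi] at hx
        exact absurd hx List.not_mem_nil
      · rw [plug_self, lb] at this
        omega
      · rw [plug_gt _ _ _ _ _ hxi] at hx
        exact absurd hx List.not_mem_nil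
  · exact Or.inl (same (PrimeExpr.eq_of_mem_brackets h' i' B' hd
      ((isConnectedBracket_map_shift_iff h i).2 B.1.2.1.isConnectedBracket)))
  · exact Or.inl (same (PrimeExpr.eq_of_mem_brackets h i B hd
      ((isConnectedBracket_map_shift_iff h' i').2 B'.1.2.1.isConnectedBracket)).symm)

/-- The operad `L` is free on the prime expressions. -/
theorem opL_isFreeOn : NSOperad.IsFreeOn.{w₁, 0, 0} opL PrimeExpr (fun _ p => p.1) :=
  NSOperad.isFreeOn_of_decomp (fun _ => two_le_of_prime) opL_one_unique exists_decomp_opL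
    decomp_opL_eq_or_parallel

/-! ### Oriented expressions span the multilinear brackets -/

section Span

variable (R : Type*) [CommRing R] {α : Type*} [LinearOrder α]

/-- The span of the values of the oriented expressions with a given multiset of symbols. -/
noncomputable def orientedSpan (l : List α) : Submodule R (FreeLieAlgebra R α) :=
  Submodule.span R {f | ∃ B, IsOriented B ∧ (leaves B).Perm l ∧ toLie R B = f}

variable {R}

theorem orientedSpan_congr {l l' : List α} (h : l.Perm l') :
    orientedSpan R l = orientedSpan R l' := by
  have : ∀ B : FreeMagma α, (leaves B).Perm l ↔ (leaves B).Perm l' := fun B =>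
    ⟨fun h' => h'.trans h, fun h' => h'.trans h.symm⟩
  simp only [orientedSpan, this]

theorem toLie_mem_orientedSpan {B : FreeMagma α} {l : List α} (hB : IsOriented B)
    (h : (leaves B).Perm l) : toLie R B ∈ orientedSpan R l :=
  Submodule.subset_span ⟨B, hB, h, rfl⟩

theorem lie_mem_of_mem_span {L : Type*} [LieRing L] [LieAlgebra R L] {s t : Set L}
    {M : Submodule R L} (h : ∀ x ∈ s, ∀ y ∈ t, ⁅x, y⁆ ∈ M) {x y : L}
    (hx : x ∈ Submodule.span R s) (hy : y ∈ Submodule.span R t) : ⁅x, y⁆ ∈ M := by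
  induction hx using Submodule.span_induction with
  | mem x hx =>
    induction hy using Submodule.span_induction with
    | mem y hy => exact h x hx y hy
    | zero => rw [lie_zero]; exact M.zero_mem
    | add y z _ _ hy hz => rw [lie_add]; exact M.add_mem hy hz
    | smul r y _ hy => rw [lie_smul]; exact M.smul_mem r hy
  | zero => rw [zero_lie]; exact M.zero_mem
  | add y z _ _ hy hz => rw [add_lie]; exact M.add_mem hy hz
  | smul r y _ hy => rw [smul_lie]; exact M.smul_mem r hy

/-- If the largest symbol is in `b`, the bracket is already oriented. Otherwise `a = [p, q]` with
the smallest symbol in `p` and the largest in `q`, and Jacobi gives `[[p, q], b] = [[p, b], q] + [p,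
[q, b]]`. Rewriting the shorter inner brackets `[p, b]` and `[q, b]` by oriented ones makes both
terms oriented. -/
theorem lie_mem_orientedSpan_of_min {a b : FreeMagma α}
    (ih : ∀ A : FreeMagma α, (leaves A).length < (leaves (a * b)).length → (leaves A).Nodup →
      toLie R A ∈ orientedSpan R (leaves A))
    (hnd : (leaves (a * b)).Nodup) (ha : IsOriented a) (hb : IsOriented b)
    (hmin : ∃ x ∈ leaves a, ∀ y ∈ leaves (a * b), x ≤ y) :
    ⁅toLie R a, toLie R b⁆ ∈ orientedSpan R (leaves (a * b)) := by
  obtain ⟨z, hz, hmax⟩ := exists_max_leaf (a * b)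
  have hz' := hz
  rw [leaves_mul, List.mem_append] at hz
  rcases hz with hz | hz
  swap
  · rw [← toLie_mul]
    exact toLie_mem_orientedSpan ((isOriented_mul a b).2 ⟨⟨hmin, z, hz, hmax⟩, ha, hb⟩)
      (List.Perm.refl _)
  obtain ⟨x, hx, hmin⟩ := hmin
  cases a using FreeMagma.recOnMul with
  | ih1 w =>
    -- A single symbol that is both smallest and largest leaves no different symbol for `b`.
    exfalso
    obtain ⟨u, hu⟩ := List.exists_mem_of_ne_nil _ (leaves_ne_nil b)
    rw [leaves_of, List.mem_singleton] at hx hz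
    subst hx
    subst hz
    have hu' : u ∈ leaves (FreeMagma.of z * b) := by simp [leaves_mul, hu]
    have : u = z := le_antisymm (hmax u hu') (hmin u hu')
    subst this
    rw [leaves_mul, List.nodup_append'] at hnd
    exact hnd.2.2 (by simp [leaves_of]) hu
  | ih2 p q =>
    obtain ⟨⟨⟨x', hx', hmin'⟩, ⟨z', hz₁, hmax'⟩⟩, hp, hq⟩ := (isOriented_mul p q).1 ha
    have hpmin : ∀ y ∈ leaves (p * q * b), x' ≤ y := fun y hy => (hmin' x hx).trans (hmin y hy)
    have hqmax : ∀ y ∈ leaves (p * q * b), y ≤ z' := fun y hy => (hmax y hy).trans (hmax' z hz)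
    have e : ⁅toLie R (p * q), toLie R b⁆
        = ⁅toLie R (p * b), toLie R q⁆ + ⁅toLie R p, toLie R (q * b)⁆ := by
      simp only [toLie_mul]
      rw [lie_lie, ← lie_skew (⁅toLie R p, toLie R b⁆) (toLie R q)]
      abel
    have hlen := length_leaves_pos p
    have hlen' := length_leaves_pos q
    simp only [leaves_mul, List.length_append, List.mem_append] at ih hpmin hqmax hnd ⊢
    have hperm : (leaves p ++ leaves q ++ leaves b).Perm ((leaves p ++ leaves b) ++ leaves q) := by
      rw [List.append_assoc, List.append_assoc]
      exact List.Perm.append_left _ List.perm_append_comm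
    rw [e]
    refine Submodule.add_mem _ ?_ ?_
    · have h₁ := ih (p * b) (by rw [leaves_mul, List.length_append]; omega) (by
        rw [leaves_mul]
        exact (hperm.nodup_iff.1 hnd).sublist (List.sublist_append_left _ _))
      refine lie_mem_of_mem_span ?_ h₁ (Submodule.mem_span_singleton_self (toLie R q))
      rintro _ ⟨c, hc, hcp, rfl⟩ _ rfl
      rw [leaves_mul] at hcp
      rw [← toLie_mul]
      refine toLie_mem_orientedSpan ((isOriented_mul c q).2
        ⟨⟨⟨x', hcp.mem_iff.2 (by simp [hx']), fun y hy => hpmin y ?_⟩,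
          ⟨z', hz₁, fun y hy => hqmax y ?_⟩⟩, hc, hq⟩) ?_
      · rw [leaves_mul, List.mem_append, hcp.mem_iff, List.mem_append] at hy; tauto
      · rw [leaves_mul, List.mem_append, hcp.mem_iff, List.mem_append] at hy; tauto
      · rw [leaves_mul]
        exact (hcp.append_right _).trans hperm.symm
    · have h₁ := ih (q * b) (by rw [leaves_mul, List.length_append]; omega) (by
        rw [leaves_mul]
        rw [List.append_assoc] at hnd
        exact hnd.sublist (List.sublist_append_right _ _))
      refine lie_mem_of_mem_span ?_ (Submodule.mem_span_singleton_self (toLie R p)) h₁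
      rintro _ rfl _ ⟨c, hc, hcp, rfl⟩
      rw [leaves_mul] at hcp
      rw [← toLie_mul]
      refine toLie_mem_orientedSpan ((isOriented_mul p c).2
        ⟨⟨⟨x', hx', fun y hy => hpmin y ?_⟩,
          ⟨z', hcp.mem_iff.2 (by simp [hz₁]), fun y hy => hqmax y ?_⟩⟩, hp, hc⟩) ?_
      · rw [leaves_mul, List.mem_append, hcp.mem_iff, List.mem_append] at hy; tauto
      · rw [leaves_mul, List.mem_append, hcp.mem_iff, List.mem_append] at hy; tauto
      · rw [leaves_mul, List.append_assoc]
        exact hcp.append_left _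

/-- The oriented expressions span the multilinear iterated brackets. -/
theorem toLie_mem_orientedSpan_of_nodup (A : FreeMagma α) (hA : (leaves A).Nodup) :
    toLie R A ∈ orientedSpan R (leaves A) := by
  induction hN : (leaves A).length using Nat.strong_induction_on generalizing A with
  | _ N ih =>
  have ih' : ∀ B : FreeMagma α, (leaves B).length < (leaves A).length → (leaves B).Nodup →
      toLie R B ∈ orientedSpan R (leaves B) := fun B hB hnd => ih _ (hN ▸ hB) B hnd rfl
  clear ih hN
  cases A using FreeMagma.recOnMul with
  | ih1 x => exact toLie_mem_orientedSpan (isOriented_of x) (List.Perm.refl _)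
  | ih2 a b =>
    have hlen := length_leaves_pos a
    have hlen' := length_leaves_pos b
    have hA' := hA
    rw [leaves_mul, List.nodup_append'] at hA'
    have h₁ := ih' a (by rw [leaves_mul, List.length_append]; omega) hA'.1
    have h₂ := ih' b (by rw [leaves_mul, List.length_append]; omega) hA'.2.1
    rw [toLie_mul]
    refine lie_mem_of_mem_span ?_ h₁ h₂
    rintro _ ⟨c, hc, hca, rfl⟩ _ ⟨d, hd, hdb, rfl⟩
    have hperm : (leaves (c * d)).Perm (leaves (a * b)) := hca.append hdb
    have hperm' : (leaves (d * c)).Perm (leaves (a * b)) :=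
      List.perm_append_comm.trans hperm
    obtain ⟨x, hx, hmin⟩ := exists_min_leaf (c * d)
    rw [leaves_mul, List.mem_append] at hx
    rcases hx with hx | hx
    · rw [← orientedSpan_congr hperm]
      exact lie_mem_orientedSpan_of_min (fun B hB => ih' B (hperm.length_eq ▸ hB))
        (hperm.nodup_iff.2 hA) hc hd ⟨x, hx, hmin⟩
    -- The smallest symbol is on the right, so the factors are exchanged at the cost of a sign.
    · rw [← orientedSpan_congr hperm', ← lie_skew]
      refine Submodule.neg_mem _ (lie_mem_orientedSpan_of_min
        (fun B hB => ih' B (hperm'.length_eq ▸ hB)) (hperm'.nodup_iff.2 hA) hd hc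
        ⟨x, hx, fun y hy => hmin y ?_⟩)
      exact hperm.mem_iff.2 (hperm'.mem_iff.1 hy)

end Span

/-! ### Words and right-normed brackets -/

section Words

attribute [local instance] LieRing.ofAssociativeRing

variable (R : Type*) [CommRing R] {α : Type*}

/-- The representation of the free Lie algebra on the free module on words in which generators
act by prepending letters, except that on the empty word only `z` acts non-trivially. -/
noncomputable def wordRep [DecidableEq α] (z : α) : FreeLieAlgebra R α →ₗ⁅R⁆ Module.End R (List α →₀ R) :=
  FreeLieAlgebra.lift R fun x => Finsupp.linearCombination R fun w : List α =>
    if w = [] ∧ x ≠ z then 0 else Finsupp.single (x :: w) 1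

/-- The right-normed bracket of the letters of a word, ending in `z`. -/
def rightNormed (z : α) : List α → FreeMagma α
  | [] => .of z
  | x :: l => .of x * rightNormed z l

theorem leaves_rightNormed (z : α) (l : List α) : leaves (rightNormed z l) = l ++ [z] := by
  induction l with
  | nil => rfl
  | cons x l ih => rw [rightNormed, leaves_mul, ih]; rfl

/-- Applied to the empty word, an element yields the part of its associative expansion carried by
words ending in `z`. In each commutator only the term with `x` prepended last survives, since `x ≠
z` kills the empty word. -/
theorem wordRep_rightNormed [DecidableEq α] (z : α) (l : List α) (hz : z ∉ l) :
    wordRep R z (toLie R (rightNormed z l)) (Finsupp.single [] 1)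
      = Finsupp.single (l ++ [z]) 1 := by
  induction l with
  | nil => simp [rightNormed, toLie_of, wordRep]
  | cons x l ih =>
    rw [List.mem_cons, not_or] at hz
    rw [rightNormed, toLie_mul, LieHom.map_lie, LieRing.of_associative_ring_bracket,
      LinearMap.sub_apply, Module.End.mul_apply, Module.End.mul_apply, ih hz.2]
    have h₁ : wordRep R z (toLie R (FreeMagma.of x)) (Finsupp.single [] 1) = 0 := by
      simp [toLie_of, wordRep, Ne.symm hz.1]
    rw [h₁, map_zero, sub_zero]
    simp [toLie_of, wordRep]

end Words

/-! ### Encoding oriented expressions by words -/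

section Encoding

variable {α : Type*}

/-- Two words encoding an expression: for an oriented expression, the first one ends in the
smallest symbol, the second one in the largest. -/
def endWords : FreeMagma α → List α × List α
  | .of x => ([x], [x])
  | .mul a b => ((endWords b).2 ++ (endWords a).1, (endWords a).1 ++ (endWords b).2)

theorem endWords_mul (a b : FreeMagma α) : endWords (a * b) =
    ((endWords b).2 ++ (endWords a).1, (endWords a).1 ++ (endWords b).2) := rfl

theorem endWords_perm (A : FreeMagma α) :
    (endWords A).1.Perm (leaves A) ∧ (endWords A).2.Perm (leaves A) := by
  induction A with
  | ih1 x => exact ⟨List.Perm.refl _, List.Perm.refl _⟩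
  | ih2 a b ha hb =>
    rw [endWords_mul, leaves_mul]
    exact ⟨List.perm_append_comm.trans (ha.1.append hb.2), ha.1.append hb.2⟩

theorem append_cons_inj_of_nodup {l₁ l₂ m₁ m₂ : List α} {x : α}
    (h : l₁ ++ x :: m₁ = l₂ ++ x :: m₂) (hnd : (l₁ ++ x :: m₁).Nodup) : l₁ = l₂ ∧ m₁ = m₂ := by
  have hx := List.nodup_middle.1 hnd
  rw [List.nodup_cons, List.mem_append, not_or] at hx
  have := (List.append_cons_inj_of_notMem hx.1.1 hx.1.2).1 h
  exact ⟨this.1, this.2.2⟩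

variable [LinearOrder α]

/-- The last letter of each word is a known extremal symbol. It marks where the words of `a` and `b`
were concatenated and lets `endWords_injOn` undo this. -/
theorem endWords_eq_append (A : FreeMagma α) (hA : IsOriented A) :
    (∃ l m, (endWords A).1 = l ++ [m] ∧ ∀ y ∈ leaves A, m ≤ y) ∧
      ∃ l m, (endWords A).2 = l ++ [m] ∧ ∀ y ∈ leaves A, y ≤ m := by
  induction A with
  | ih1 x => exact ⟨⟨[], x, rfl, by simp [leaves_of]⟩, ⟨[], x, rfl, by simp [leaves_of]⟩⟩
  | ih2 a b ha hb =>
    obtain ⟨⟨⟨x, hx, hmin⟩, ⟨z, hz, hmax⟩⟩, h₁, h₂⟩ := (isOriented_mul a b).1 hA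
    obtain ⟨l, m, e, hm⟩ := (ha h₁).1
    obtain ⟨l', m', e', hm'⟩ := (hb h₂).2
    rw [endWords_mul]
    refine ⟨⟨(endWords b).2 ++ l, m, by simp [e], fun y hy => (hm x hx).trans (hmin y hy)⟩,
      ⟨(endWords a).1 ++ l', m', by simp [e'], fun y hy => (hmax y hy).trans (hm' z hz)⟩⟩

/-- An oriented expression without repeated symbols is determined by either of its words. -/
theorem endWords_injOn (A A' : FreeMagma α) (hA : IsOriented A) (hA' : IsOriented A')
    (hnd : (leaves A).Nodup) :
    ((endWords A).1 = (endWords A').1 → A = A') ∧ ((endWords A).2 = (endWords A').2 → A = A') := by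
  have hlen : ∀ (x : α) (a b : FreeMagma α), ¬ [x].Perm (leaves (a * b)) := by
    intro x a b h
    have := h.length_eq
    rw [leaves_mul, List.length_append, List.length_singleton] at this
    have := length_leaves_pos a
    have := length_leaves_pos b
    omega
  induction A generalizing A' with
  | ih1 x =>
    cases A' using FreeMagma.recOnMul with
    | ih1 y =>
      simp only [endWords, List.cons.injEq, and_true]
      exact ⟨congrArg _, congrArg _⟩
    | ih2 a b =>
      exact ⟨fun h => (hlen x a b ((List.Perm.of_eq h).trans (endWords_perm (a * b)).1)).elim,
        fun h => (hlen x a b ((List.Perm.of_eq h).trans (endWords_perm (a * b)).2)).elim⟩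
  | ih2 a b iha ihb =>
    cases A' using FreeMagma.recOnMul with
    | ih1 y =>
      exact ⟨fun h => (hlen y a b ((List.Perm.of_eq h.symm).trans (endWords_perm (a * b)).1)).elim,
        fun h => (hlen y a b ((List.Perm.of_eq h.symm).trans (endWords_perm (a * b)).2)).elim⟩
    | ih2 a' b' =>
      have hsplit : ∀ {p q : List α}, p.Perm (leaves (a * b)) → p = q →
          q.Perm (leaves (a' * b')) → ∀ y, y ∈ leaves (a * b) ↔ y ∈ leaves (a' * b') := by
        rintro p q hp rfl hq y
        rw [← hp.mem_iff, hq.mem_iff]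
      have hnd' := hnd
      rw [leaves_mul, List.nodup_append'] at hnd'
      obtain ⟨⟨⟨x, hx, hmin⟩, ⟨z, hz, hmax⟩⟩, h₁, h₂⟩ := (isOriented_mul a b).1 hA
      obtain ⟨⟨⟨x', hx', hmin'⟩, ⟨z', hz', hmax'⟩⟩, h₁', h₂'⟩ := (isOriented_mul a' b').1 hA'
      have ia := (iha a' h₁ h₁' hnd'.1).1
      have ib := (ihb b' h₂ h₂' hnd'.2.1).2
      obtain ⟨l, m, e, hm⟩ := (endWords_eq_append a h₁).1
      obtain ⟨l', m', e', hm'⟩ := (endWords_eq_append a' h₁').1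
      obtain ⟨r, M, f, hM⟩ := (endWords_eq_append b h₂).2
      obtain ⟨r', M', f', hM'⟩ := (endWords_eq_append b' h₂').2
      have mema : m ∈ leaves (a * b) := by
        rw [leaves_mul, List.mem_append, ← (endWords_perm a).1.mem_iff, e]; simp
      have mema' : m' ∈ leaves (a' * b') := by
        rw [leaves_mul, List.mem_append, ← (endWords_perm a').1.mem_iff, e']; simp
      have memb : M ∈ leaves (a * b) := by
        rw [leaves_mul, List.mem_append, ← (endWords_perm b).2.mem_iff, f]; simp
      have memb' : M' ∈ leaves (a' * b') := by
        rw [leaves_mul, List.mem_append, ← (endWords_perm b').2.mem_iff, f']; simp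
      have p₁ := endWords_perm (a * b)
      have p₂ := endWords_perm (a' * b')
      constructor
      · intro h
        have hmem := hsplit p₁.1 h p₂.1
        -- Equal words use the same letters, so their largest letters agree. The part up to that
        -- letter is the second word of `b`, the rest the first word of `a`.
        obtain rfl : M = M' := le_antisymm
          ((hmax' M ((hmem M).1 memb)).trans (hM' z' hz'))
          ((hmax M' ((hmem M').2 memb')).trans (hM z hz))
        have hn := p₁.1.nodup_iff.2 hnd
        simp only [endWords_mul, f, f', List.append_assoc, List.singleton_append] at h hn
        obtain ⟨rfl, h'⟩ := append_cons_inj_of_nodup h hn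
        rw [ia h', ib (f.trans f'.symm)]
      · intro h
        have hmem := hsplit p₁.2 h p₂.2
        -- Symmetrically, the second word is cut after its smallest letter, where the first word of
        -- `a` ends.
        obtain rfl : m = m' := le_antisymm
          ((hm x hx).trans (hmin m' ((hmem m').2 mema')))
          ((hm' x' hx').trans (hmin' m ((hmem m).1 mema)))
        have hn := p₁.2.nodup_iff.2 hnd
        simp only [endWords_mul, e, e', List.append_assoc, List.singleton_append] at h hn
        obtain ⟨rfl, h'⟩ := append_cons_inj_of_nodup h hn
        rw [ia (e.trans e'.symm), ib h']

end Encoding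

/-! ### Linear independence of the oriented expressions -/

/-- The words in which each of `k + 1` letters occurs once and whose last letter is the first
letter of the alphabet. -/
def EndingWord (k : ℕ) : Type :=
  {w : List (Fin (k + 1)) // w.Perm (List.finRange (k + 1)) ∧ ∃ l, w = l ++ [0]}

instance (k : ℕ) : Finite (EndingWord k) := by
  refine Set.Finite.subset (List.finite_toSet (List.finRange (k + 1)).permutations) ?_
  rintro w ⟨hw, -⟩
  exact List.mem_permutations.2 hw

section Basis

attribute [local instance] LieRing.ofAssociativeRing

variable (R : Type*) [CommRing R]

/-- The linear extension of the evaluation of expressions in the free Lie algebra. -/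
noncomputable def evalSpan (k : ℕ) : (opL.obj k →₀ R) →ₗ[R] FreeLieAlgebra R (Fin k) :=
  Finsupp.linearCombination R fun A => toLie R A.1

theorem range_evalSpan (k : ℕ) : LinearMap.range (evalSpan R k) = multilinearPart R k := by
  rw [evalSpan, Finsupp.range_linearCombination]
  refine le_antisymm (Submodule.span_mono ?_) (Submodule.span_le.2 ?_)
  · rintro _ ⟨A, rfl⟩
    exact ⟨A.1, A.2.1, rfl⟩
  · rintro _ ⟨A, hA, rfl⟩
    refine Submodule.span_mono ?_ (toLie_mem_orientedSpan_of_nodup A hA.nodup)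
    rintro _ ⟨B, hB, hBA, rfl⟩
    exact ⟨⟨B, fun i => by rw [hBA.count_eq, hA i], hB⟩, rfl⟩

/-- The encoding of an expression in `L(k + 1)` by a word. -/
def encode {k : ℕ} (A : opL.obj (k + 1)) : EndingWord k :=
  ⟨(endWords A.1).1, (endWords_perm A.1).1.trans A.2.1.perm, by
    obtain ⟨l, m, e, hm⟩ := (endWords_eq_append A.1 A.2.2).1
    have := hm 0 (A.2.1.mem 0)
    rw [Fin.le_zero_iff] at this
    exact ⟨l, this ▸ e⟩⟩

theorem encode_injective {k : ℕ} : Function.Injective (encode (k := k)) := fun A A' h =>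
  Subtype.ext ((endWords_injOn A.1 A'.1 A.2.2 A'.2.2 A.2.1.nodup).1 (congrArg Subtype.val h))

/-- The coefficients of the words that end in the first letter. -/
noncomputable def wordCoeff (k : ℕ) : FreeLieAlgebra R (Fin (k + 1)) →ₗ[R] EndingWord k →₀ R :=
  (Finsupp.lcomapDomain Subtype.val Subtype.val_injective).comp
    ((LinearMap.applyₗ (Finsupp.single [] 1)).comp (wordRep R (0 : Fin (k + 1))).toLinearMap)

/-- Each word `l ++ [0]` is hit by the right-normed bracket of its letters. That bracket need not be
oriented, but it is multilinear, so `range_evalSpan` rewrites it as a combination of oriented ones.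
-/
theorem wordCoeff_comp_evalSpan_surjective (k : ℕ) :
    Function.Surjective ((wordCoeff R k).comp (evalSpan R (k + 1))) := by
  have key : ∀ w, Finsupp.single w 1 ∈
      LinearMap.range ((wordCoeff R k).comp (evalSpan R (k + 1))) := by
    rintro ⟨w, hw, l, rfl⟩
    have hnd := hw.nodup_iff.2 (List.nodup_finRange _)
    have hmem : toLie R (rightNormed 0 l) ∈ LinearMap.range (evalSpan R (k + 1)) := by
      rw [range_evalSpan]
      refine toLie_mem R (isMultilinear_iff.2 ?_)
      rw [leaves_rightNormed]
      exact ⟨hnd, fun x => hw.mem_iff.2 (List.mem_finRange x)⟩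
    obtain ⟨p, hp⟩ := hmem
    refine ⟨p, ?_⟩
    have hz : (0 : Fin (k + 1)) ∉ l := fun h =>
      (List.nodup_append'.1 hnd).2.2 h (List.mem_singleton_self _)
    rw [LinearMap.comp_apply, hp]
    refine (congrArg (Finsupp.lcomapDomain (R := R) Subtype.val Subtype.val_injective)
      (wordRep_rightNormed R 0 l hz)).trans ?_
    exact Finsupp.comapDomain_single Subtype.val
      (⟨l ++ [0], hw, l, rfl⟩ : EndingWord k) 1 Subtype.val_injective.injOn
  intro x
  rw [← LinearMap.mem_range]
  induction x using Finsupp.induction_linear with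
  | zero => exact Submodule.zero_mem _
  | add f g hf hg => exact Submodule.add_mem _ hf hg
  | single w r =>
    rw [← mul_one r, ← smul_eq_mul, ← Finsupp.smul_single]
    exact Submodule.smul_mem _ r (key w)

theorem evalSpan_injective (k : ℕ) : Function.Injective (evalSpan R k) := by
  cases k with
  | zero =>
    have : IsEmpty (opL.obj 0) := ⟨fun A => by
      obtain ⟨u, -⟩ := List.exists_mem_of_ne_nil _ (leaves_ne_nil A.1)
      exact u.elim0⟩
    exact Function.injective_of_subsingleton _
  | succ k =>
    -- The injection induced by `encode` and the surjection have the same source and the same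
    -- finitely generated target. They are otherwise unrelated, and Orzech's property makes the
    -- surjection injective.
    have := OrzechProperty.injective_of_surjective_of_injective
      (Finsupp.lmapDomain R R (encode (k := k))) ((wordCoeff R k).comp (evalSpan R (k + 1)))
      (Finsupp.mapDomain_injective encode_injective) (wordCoeff_comp_evalSpan_surjective R k)
    exact Function.Injective.of_comp (f := wordCoeff R k) this

end Basis

/-! ### The linear span of a free operad in sets -/

theorem LinNSOperad.Hom.ext_map.{v, w} {R : Type*} [CommRing R] {O : LinNSOperad.{_, v} R}
    {Q : LinNSOperad.{_, w} R} {φ ψ : LinNSOperad.Hom O Q} (h : ∀ n A, φ.map n A = ψ.map n A) :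
    φ = ψ := by
  cases φ; cases ψ
  congr
  funext n
  exact LinearMap.ext (h n)

/-- The operad in sets that underlies an operad in modules. -/
def LinNSOperad.toNSOperad.{v} {R : Type*} [CommRing R] (Q : LinNSOperad.{_, v} R) :
    NSOperad.{v} where
  obj := Q.obj
  one := Q.one
  circ h i a b := Q.circ h i a b
  one_circ := Q.one_circ
  circ_one := Q.circ_one
  circ_seq := Q.circ_seq
  circ_par := Q.circ_par

section Span

variable {R : Type u} [CommRing R]

/-- An operation of `O`, as a basis element of `R[O]`. -/
noncomputable def NSOperad.toSpan.{v} (R : Type u) [CommRing R] {O : NSOperad.{v}} {n : ℕ}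
    (A : O.obj n) : (O.span R).obj n :=
  Finsupp.single A (1 : R)

/-- The linear extension to `R[O]` of a map on operations. -/
noncomputable def NSOperad.spanLift.{v, w} {O : NSOperad.{v}} {n : ℕ} {M : Type w}
    [AddCommGroup M] [Module R M] (f : O.obj n → M) : (O.span R).obj n →ₗ[R] M :=
  Finsupp.linearCombination R f

theorem NSOperad.spanLift_toSpan.{v, w} {O : NSOperad.{v}} {n : ℕ} {M : Type w}
    [AddCommGroup M] [Module R M] (f : O.obj n → M) (A : O.obj n) :
    NSOperad.spanLift f (O.toSpan R A) = f A :=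
  (Finsupp.linearCombination_single R 1 A).trans (one_smul R _)

theorem NSOperad.span_linearMap_ext.{v, w} {O : NSOperad.{v}} {n : ℕ} {M : Type w}
    [AddCommGroup M] [Module R M] {f g : (O.span R).obj n →ₗ[R] M}
    (h : ∀ A : O.obj n, f (O.toSpan R A) = g (O.toSpan R A)) : f = g :=
  Finsupp.lhom_ext' (φ := (f : (O.obj n →₀ R) →ₗ[R] M)) (ψ := g) fun A => LinearMap.ext_ring (h A)

theorem NSOperad.span_circ_toSpan.{v} {O : NSOperad.{v}} {m n k : ℕ} (h : m + n = k + 1)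
    (i : Fin m) (a : O.obj m) (b : O.obj n) :
    (O.span R).circ h i (O.toSpan R a) (O.toSpan R b) = O.toSpan R (O.circ h i a b) :=
  (linearCombination_lmapDomain_single (O.circ h i) a (1 : R) b 1).trans
    (congrArg (Finsupp.single _) (mul_one 1))

theorem NSOperad.spanLift_circ.{v, w} {O : NSOperad.{v}} {Q : LinNSOperad.{u, w} R}
    (F : ∀ n, O.obj n → Q.obj n)
    (hF : ∀ {m n k : ℕ} (h : m + n = k + 1) (i : Fin m) (a : O.obj m) (b : O.obj n),
      F k (O.circ h i a b) = Q.circ h i (F m a) (F n b))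
    {m n k : ℕ} (h : m + n = k + 1) (i : Fin m) (a : (O.span R).obj m) (b : (O.span R).obj n) :
    NSOperad.spanLift (F k) ((O.span R).circ h i a b)
      = Q.circ h i (NSOperad.spanLift (F m) a) (NSOperad.spanLift (F n) b) := by
  have : ((O.span R).circ h i).compr₂ (NSOperad.spanLift (F k)) =
      (Q.circ h i).compl₁₂ (NSOperad.spanLift (F m)) (NSOperad.spanLift (F n)) := by
    refine NSOperad.span_linearMap_ext fun a => NSOperad.span_linearMap_ext fun b => ?_
    rw [LinearMap.compr₂_apply, LinearMap.compl₁₂_apply, NSOperad.span_circ_toSpan,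
      NSOperad.spanLift_toSpan, NSOperad.spanLift_toSpan, NSOperad.spanLift_toSpan, hF]
  exact LinearMap.congr_fun₂ this a b

/-- The linear extension of a morphism from an operad in sets to an operad in modules. -/
noncomputable def NSOperad.Hom.linearize.{v, w} {O : NSOperad.{v}} {Q : LinNSOperad.{u, w} R}
    (φ : NSOperad.Hom O Q.toNSOperad) : LinNSOperad.Hom (O.span R) Q where
  map n := NSOperad.spanLift (M := Q.obj n) (φ.map n)
  map_one := (NSOperad.spanLift_toSpan (M := Q.obj 1) (φ.map 1) O.one).trans φ.map_one
  map_circ := NSOperad.spanLift_circ (fun n => φ.map n) φ.map_circ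

theorem NSOperad.Hom.linearize_toSpan.{v, w} {O : NSOperad.{v}} {Q : LinNSOperad.{u, w} R}
    (φ : NSOperad.Hom O Q.toNSOperad) (n : ℕ) (A : O.obj n) :
    φ.linearize.map n (O.toSpan R A) = φ.map n A :=
  NSOperad.spanLift_toSpan (M := Q.obj n) (φ.map n) A

/-- The morphism of operads in sets given by the values on basis elements. -/
noncomputable def LinNSOperad.Hom.restrictBasis.{v, w} {O : NSOperad.{v}}
    {Q : LinNSOperad.{u, w} R} (φ : LinNSOperad.Hom (O.span R) Q) :
    NSOperad.Hom O Q.toNSOperad where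
  map n A := φ.map n (O.toSpan R A)
  map_one := φ.map_one
  map_circ h i a b := by
    rw [← NSOperad.span_circ_toSpan, φ.map_circ]
    rfl

end Span

/-- The composition of morphisms of operads in modules. -/
def LinNSOperad.Hom.comp.{v₁, v₂, v₃} {R : Type*} [CommRing R] {O : LinNSOperad.{_, v₁} R}
    {Q : LinNSOperad.{_, v₂} R} {S : LinNSOperad.{_, v₃} R} (ψ : LinNSOperad.Hom Q S)
    (φ : LinNSOperad.Hom O Q) : LinNSOperad.Hom O S where
  map n := (ψ.map n).comp (φ.map n)
  map_one := by rw [LinearMap.comp_apply, φ.map_one, ψ.map_one]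
  map_circ h i a b := by simp only [LinearMap.comp_apply, φ.map_circ, ψ.map_circ]

/-- The inverse of a bijective morphism of operads in modules. -/
noncomputable def LinNSOperad.Hom.inv.{v₁, v₂} {R : Type*} [CommRing R] {O : LinNSOperad.{_, v₁} R}
    {Q : LinNSOperad.{_, v₂} R} (φ : LinNSOperad.Hom O Q)
    (hφ : ∀ n, Function.Bijective (φ.map n)) : LinNSOperad.Hom Q O where
  map n := (LinearEquiv.ofBijective (φ.map n) (hφ n)).symm.toLinearMap
  map_one := (LinearEquiv.symm_apply_eq _).2 φ.map_one.symm
  map_circ {m n k} h i a b := by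
    refine (LinearEquiv.symm_apply_eq (LinearEquiv.ofBijective (φ.map k) (hφ k))).2 ?_
    rw [LinearEquiv.ofBijective_apply, φ.map_circ]
    congr 1
    · congr 1
      exact ((LinearEquiv.ofBijective (φ.map m) (hφ m)).apply_symm_apply a).symm
    · exact ((LinearEquiv.ofBijective (φ.map n) (hφ n)).apply_symm_apply b).symm

/-- An operad in modules isomorphic to the linear span of a free operad in sets is free. -/
theorem LinNSOperad.isFreeOn_of_bijective.{v, v', v₂, w} {R : Type u} [CommRing R]
    {O : NSOperad.{v}} {X : ℕ → Type v'} {ι : ∀ n, X n → O.obj n}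
    (hO : NSOperad.IsFreeOn.{w} O X ι) {L : LinNSOperad.{u, v₂} R}
    (β : LinNSOperad.Hom (O.span R) L) (hβ : ∀ n, Function.Bijective (β.map n)) :
    LinNSOperad.IsFreeOn.{w} L (fun n => X n →₀ R) fun n =>
      Finsupp.linearCombination R fun x => β.map n (Finsupp.single (ι n x) 1) := by
  intro Q f
  obtain ⟨φ, hφ, huniq⟩ := hO Q.toNSOperad fun n x => f n (Finsupp.single x 1)
  have hinv : ∀ n A, (β.inv hβ).map n (β.map n A) = A := fun n A =>
    (LinearEquiv.ofBijective (β.map n) (hβ n)).symm_apply_apply A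
  have hcomp : ∀ n (A : O.obj n),
      (φ.linearize.comp (β.inv hβ)).map n (β.map n (O.toSpan R A)) = φ.map n A := fun n A =>
    (congrArg (φ.linearize.map n) (hinv n _)).trans (φ.linearize_toSpan n A)
  refine ⟨φ.linearize.comp (β.inv hβ), fun n x => ?_, fun ψ hψ => ?_⟩
  · refine LinearMap.congr_fun (f := ((φ.linearize.comp (β.inv hβ)).map n).comp
      (Finsupp.linearCombination R fun x => β.map n (O.toSpan R (ι n x)))) (g := f n)
      (Finsupp.lhom_ext' fun y => LinearMap.ext_ring ?_) x
    rw [LinearMap.comp_apply, LinearMap.comp_apply, Finsupp.lsingle_apply,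
      Finsupp.linearCombination_single, one_smul, hcomp]
    exact hφ n y
  -- Pulled back to `O`, any extension is a morphism of operads in sets with the prescribed values
  -- on generators; it is therefore `φ`, and basis elements determine the rest.
  · have h₂ : (ψ.comp β).restrictBasis = φ := huniq _ fun n x => by
      have := hψ n (Finsupp.single x 1)
      rw [Finsupp.linearCombination_single, one_smul] at this
      exact this
    have h₃ : ∀ n, (ψ.map n).comp (β.map n)
        = ((φ.linearize.comp (β.inv hβ)).map n).comp (β.map n) := fun n =>
      NSOperad.span_linearMap_ext fun A => by
        rw [LinearMap.comp_apply, LinearMap.comp_apply, hcomp, ← h₂]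
        rfl
    apply LinNSOperad.Hom.ext_map
    intro n A
    obtain ⟨A, rfl⟩ := (hβ n).2 A
    exact LinearMap.congr_fun (h₃ n) A

/-! ### The isomorphism from the span of `L` to Lie -/

/-- The morphism from the span of `L` to the operad Lie given by evaluation of expressions. -/
noncomputable def evalHom (R : Type u) [CommRing R] :
    LinNSOperad.Hom (NSOperad.span R opL) (opLie R) :=
  NSOperad.Hom.linearize (Q := opLie R)
    { map := fun _ A => exprToLie R A
      map_one := rfl
      map_circ := fun h i a b => Subtype.ext (composeLie_toLie h i a.1 b.1).symm }

theorem evalHom_single (R : Type u) [CommRing R] (n : ℕ) (A : opL.obj n) :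
    (evalHom R).map n (Finsupp.single A 1) = exprToLie R A :=
  NSOperad.Hom.linearize_toSpan (Q := opLie R) _ n A

theorem coe_evalHom (R : Type u) [CommRing R] (n : ℕ) (A : opL.obj n →₀ R) :
    ((evalHom R).map n A : multilinearPart R n).1 = evalSpan R n A := by
  have : (multilinearPart R n).subtype.comp ((evalHom R).map n) = evalSpan R n := by
    refine Finsupp.lhom_ext' fun A => LinearMap.ext_ring ?_
    refine (congrArg Subtype.val (evalHom_single R n A)).trans ?_
    exact ((Finsupp.linearCombination_single R 1 A).trans (one_smul R (toLie R A.1))).symm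
  exact LinearMap.congr_fun this A

theorem evalHom_bijective (R : Type u) [CommRing R] (n : ℕ) :
    Function.Bijective ((evalHom R).map n) := by
  constructor
  · intro A A' h
    refine evalSpan_injective R n ?_
    exact (coe_evalHom R n A).symm.trans ((congrArg Subtype.val h).trans (coe_evalHom R n A'))
  · rintro ⟨f, hf⟩
    rw [← range_evalSpan] at hf
    obtain ⟨A, rfl⟩ := hf
    exact ⟨A, Subtype.ext (coe_evalHom R n A)⟩

theorem theorem1 (R : Type u) [CommRing R] :
    NSOperad.IsFreeOn.{w₁, 0, 0} opL PrimeExpr (fun _ p => p.1) ∧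
    (∃ β : LinNSOperad.Hom (NSOperad.span R opL) (opLie R),
      (∀ (n : ℕ) (A : opL.obj n), β.map n (Finsupp.single A 1) = exprToLie R A) ∧
      ∀ n : ℕ, Function.Bijective (β.map n)) ∧
    LinNSOperad.IsFreeOn.{w₂, u, u, u} (opLie R) (fun n => PrimeExpr n →₀ R)
      (fun _ => Finsupp.linearCombination R fun p => exprToLie R p.1) := by
  refine ⟨opL_isFreeOn, ⟨evalHom R, evalHom_single R, evalHom_bijective R⟩, ?_⟩
  have := LinNSOperad.isFreeOn_of_bijective opL_isFreeOn.{w₂} (evalHom R) (evalHom_bijective R)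
  simpa only [evalHom_single] using this
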